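/- **Notation.** Let $\mathcal H_{(2)}$ be the set of complex symmetric $2\times2$ matrices $\tau$ with positive definite imaginary part. For $N\ge1$ let $\Gamma_0(N)$ be the group of matrices $\begin{pmatrix}A&B\\C&D\end{pmatrix}\in Sp_2(\mathbb Z)$ (with $2\times 2$ blocks) such that $N\mid C$. For $k\in\mathbb Z$ and a Dirichlet character $\chi$ modulo $N$, a degree $2$ Siegel modular form of weight $k$, level $N$ and character $\chi$ is a holomorphic function $f$ on $\mathcal H_{(2)}$ with $$f\big((A\tau+B)(C\tau+D)^{-1}\big)=\chi(\det D)\,\det(C\tau+D)^k f(\tau)\quad\text{for all }\begin{pmatrix}A&B\\C&D\end{pmatrix}\in\Gamma_0(N).$$ A character modulo $N$ is also regarded as a character modulo any multiple of $N$. Write $\mathrm e\{M\}=\exp(\pi i\,\mathrm{Tr}\,M)$. For an even integral $2\times2$ matrix $T$ (symmetric, integral entries, even diagonal), the $T$th Fourier coefficient of $f$, that is, the coefficient $c(T)$ in $f(\tau)=\sum_T c(T)\,\mathrm e\{T\tau\}$, is $$c(T)=\int f(X+iY)\,\mathrm e\{-T(X+iY)\}\,dX,$$ where $X$ runs over the real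 symmetric matrices modulo the integral ones and $Y$ is any positive definite real symmetric matrix. For $\gamma=\begin{pmatrix}A&B\\C&D\end{pmatrix}\in Sp_2(\mathbb Q)$ put $(f|\gamma)(\tau)=\det(C\tau+D)^{-k}f((A\tau+B)(C\tau+D)^{-1})$. Let $q$ be an odd prime, $\mathbf g(q)=\sum_{a\,(q)}e^{2\pi i a^2/q}$, and let $L\subset SL_2(\mathbb Z)$ be the subgroup of the matrices that are lower triangular modulo $q$. Define $$(f|B(q))(\tau)=f(q\tau),$$ $$f|A_0(q)=\frac1q\sum_{G}\sum_{y\,(q)} f\,\Big|\begin{pmatrix}{}^tG^{-1}&\tfrac1q\begin{pmatrix}y&0\\0&0\end{pmatrix}G\\0&G\end{pmatrix},$$ $$f|A_1(q)=\frac1{q^2\mathbf g(q)}\sum_{G,Y}\Big(\frac{y_1}q\Big) f\,\Big|\begin{pmatrix}G^{-1}&\tfrac1qY\,{}^tG\\0&{}^tG\end{pmatrix},\qquad f|A_2(q)=\frac1q\Big(\frac{-1}q\Big)\sum_{Y}\Big(\frac{\det Y}q\Big) f\,\Big|\begin{pmatrix}I&\tfrac1qY\\0&I\end{pmatrix}.$$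 Here $Y=\begin{pmatrix}y_1&y_2\\y_2&y_4\end{pmatrix}$ runs over the integral symmetric matrices with entries modulo $q$ (taken in $\{0,\dots,q-1\}$, as is $y$). In $A_0(q)$, $G$ runs over any set of representatives of $L\backslash SL_2(\mathbb Z)$; in $A_1(q)$, $G$ runs over any set of representatives of $SL_2(\mathbb Z)/L$. (The matrices $\begin{pmatrix}1&\alpha\\0&1\end{pmatrix}$, $0\le\alpha<q$, and $\begin{pmatrix}0&-1\\1&0\end{pmatrix}$ serve for both.) For $a,b\in\mathbb F_q$ write $T\simeq\langle a,b\rangle\ (q)$ if ${}^tGTG\equiv\mathrm{diag}(a,b)\ (q)$ for some $G\in GL_2(\mathbb F_q)$; write $T\simeq\mathbb H\ (q)$ if $T\simeq\langle1,-1\rangle\ (q)$ and $T\simeq\mathbb A\ (q)$ if $T\simeq\langle1,-\omega\rangle\ (q)$ with $\omega$ a non-square modulo $q$. **Proposition 3.1.** Let $f$ be a degree $2$ Siegel modular form of weight $k$, level $\mathcal N'\ge1$ and character $\chi'$, and let $q$ be an odd prime. 1. $f|B(q)$ is a degree $2$ Siegel modular form of weight $k$, level $q\mathcal N'$ and character $\chi'$.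 2. Suppose that $q\cdot\mathrm{cond}(\chi')$ divides $\mathrm{lcm}(\mathcal N',q^2)$; this is automatic if $q^2\nmid\mathcal N'$, and also if $\chi'^2=1$. Then for $i=0,1,2$, $f|A_i(q)$ is a degree $2$ Siegel modular form of weight $k$, level $\mathrm{lcm}(\mathcal N',q^2)$ and character $\chi'$. 3. Let $T$ be an even integral $2\times2$ matrix and $c(T)$ the $T$th Fourier coefficient of $f$. The $T$th coefficient of $f|A_0(q)$ is $$\begin{cases}2c(T)&\text{if }T\simeq\mathbb H\ (q),\\0&\text{if }T\simeq\mathbb A\ (q),\\c(T)&\text{if }T\simeq\langle0,2\nu\rangle\ (q),\ \nu\not\equiv0\ (q),\\(q+1)c(T)&\text{if }T\simeq\langle0,0\rangle\ (q).\end{cases}$$ The $T$th coefficient of $f|A_1(q)$ is $\left(\frac{\nu}{q}\right)c(T)$ if $T\simeq\langle2\nu,0\rangle\ (q)$ with $\nu\not\equiv0\ (q)$, and $0$ if there is no such $\nu$. The $T$th coefficient of $f|A_2(q)$ is $$\begin{cases}(q-1)c(T)&\text{if }T\simeq\langle0,\mu\rangle\ (q)\text{ for some }\mu\in\mathbb F_q,\\-c(T)&\text{if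 }T\simeq\mathbb H\text{ or }\mathbb A\ (q).\end{cases}$$ -/

import Mathlib

open Matrix MatrixGroups

noncomputable section

namespace SiegelTwist

/-- The degree 2 Siegel upper half space: complex symmetric `2 × 2` matrices with positive
definite imaginary part. -/
def upperHalfSpace : Set (Matrix (Fin 2) (Fin 2) ℂ) :=
  {τ | τ.IsSymm ∧ (τ.map Complex.im).PosDef}

/-- The symmetric matrix with entries `a, b` in the first row and `b, d` in the second. -/
def symMat {R : Type*} (a b d : R) : Matrix (Fin 2) (Fin 2) R := !![a, b; b, d]

/-- The group `Γ₀(N)` of matrices of `Sp₂(ℤ)` whose lower left block vanishes modulo `N`. -/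
def Gamma0 (N : ℕ) : Set (Matrix (Fin 2 ⊕ Fin 2) (Fin 2 ⊕ Fin 2) ℤ) :=
  {γ | γ ∈ symplecticGroup (Fin 2) ℤ ∧ ∀ i j, (N : ℤ) ∣ γ.toBlocks₂₁ i j}

/-- `f` is a degree 2 Siegel modular form of weight `k`, level `N` and character `χ`:
it is holomorphic in the three entries of `τ`, and
`f ((Aτ + B)(Cτ + D)⁻¹) = χ(det D) det(Cτ + D)^k f(τ)` for the elements of `Γ₀(N)`.
Only the values of `f` on the upper half space matter.  In degree 2 no condition at the cusps
is needed. -/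
structure IsSiegelModularForm (k : ℤ) (N : ℕ) (χ : DirichletCharacter ℂ N)
    (f : Matrix (Fin 2) (Fin 2) ℂ → ℂ) : Prop where
  holomorphic : DifferentiableOn ℂ (fun z : ℂ × ℂ × ℂ => f (symMat z.1 z.2.1 z.2.2))
    {z | symMat z.1 z.2.1 z.2.2 ∈ upperHalfSpace}
  transform : ∀ γ ∈ Gamma0 N, ∀ τ ∈ upperHalfSpace,
    f ((γ.toBlocks₁₁.map (Int.cast : ℤ → ℂ) * τ + γ.toBlocks₁₂.map (Int.cast : ℤ → ℂ)) *
        (γ.toBlocks₂₁.map (Int.cast : ℤ → ℂ) * τ + γ.toBlocks₂₂.map (Int.cast : ℤ → ℂ))⁻¹) =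
      χ ((γ.toBlocks₂₂.det : ℤ) : ZMod N) *
        (γ.toBlocks₂₁.map (Int.cast : ℤ → ℂ) * τ +
          γ.toBlocks₂₂.map (Int.cast : ℤ → ℂ)).det ^ k * f τ

/-- An even integral matrix: symmetric, with integral entries and even diagonal. -/
def IsEvenIntegral (T : Matrix (Fin 2) (Fin 2) ℤ) : Prop :=
  T.IsSymm ∧ ∀ i, Even (T i i)

/-- `e{M} = exp(π i Tr M)`. -/
def e (M : Matrix (Fin 2) (Fin 2) ℂ) : ℂ := Complex.exp (Real.pi * Complex.I * M.trace)

/-- The `T`-th coefficient in the Fourier series `∑_T c(T) e{Tτ}` of `f`, computed at height `Y`: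
`c(T) = ∫ f(X + iY) e{-T(X + iY)} dX`, where `X` runs over the real symmetric matrices modulo the
integral ones.  (For a modular form this does not depend on the positive definite matrix `Y`.) -/
def coeffAt (Y : Matrix (Fin 2) (Fin 2) ℝ) (f : Matrix (Fin 2) (Fin 2) ℂ → ℂ)
    (T : Matrix (Fin 2) (Fin 2) ℤ) : ℂ :=
  ∫ x₁ in (0 : ℝ)..1, ∫ x₂ in (0 : ℝ)..1, ∫ x₄ in (0 : ℝ)..1,
    f ((symMat x₁ x₂ x₄).map (Complex.ofReal) + Complex.I • Y.map (Complex.ofReal)) *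
      e (-(T.map (Int.cast : ℤ → ℂ) *
        ((symMat x₁ x₂ x₄).map (Complex.ofReal) + Complex.I • Y.map (Complex.ofReal))))

/-- The slash operator `(f | γ)(τ) = det(Cτ + D)^(-k) f((Aτ + B)(Cτ + D)⁻¹)`, used only for
`γ ∈ Sp₂(ℚ)`, where the usual factor `(det γ)^(k/2)` is `1`. -/
def slash (k : ℤ) (γ : Matrix (Fin 2 ⊕ Fin 2) (Fin 2 ⊕ Fin 2) ℚ)
    (f : Matrix (Fin 2) (Fin 2) ℂ → ℂ) : Matrix (Fin 2) (Fin 2) ℂ → ℂ := fun τ =>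
  (γ.toBlocks₂₁.map (Rat.cast : ℚ → ℂ) * τ + γ.toBlocks₂₂.map (Rat.cast : ℚ → ℂ)).det ^ (-k) *
    f ((γ.toBlocks₁₁.map (Rat.cast : ℚ → ℂ) * τ + γ.toBlocks₁₂.map (Rat.cast : ℚ → ℂ)) *
      (γ.toBlocks₂₁.map (Rat.cast : ℚ → ℂ) * τ + γ.toBlocks₂₂.map (Rat.cast : ℚ → ℂ))⁻¹)

/-- A matrix of `SL₂(ℤ)` as a rational matrix. -/
def ratMat (G : SL(2, ℤ)) : Matrix (Fin 2) (Fin 2) ℚ :=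
  (G : Matrix (Fin 2) (Fin 2) ℤ).map (Int.cast : ℤ → ℚ)

/-- Membership in the subgroup of `SL₂(ℤ)` of the matrices that are congruent modulo `q` to a
lower triangular one. -/
def IsLowerMod (q : ℕ) (E : SL(2, ℤ)) : Prop := (((E 0 1 : ℤ)) : ZMod q) = 0

/-- `𝒢` is a complete set of representatives for the cosets `L E` in `L \ SL₂(ℤ)`, where `L` is
the subgroup of the matrices that are lower triangular modulo `q`. -/
def IsRepsLeftQuotient (q : ℕ) (𝒢 : Finset SL(2, ℤ)) : Prop :=
  ∀ E : SL(2, ℤ), ∃! G, G ∈ 𝒢 ∧ IsLowerMod q (E * G⁻¹)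

/-- `𝒢` is a complete set of representatives for the cosets `E L` in `SL₂(ℤ) / L`, where `L` is
the subgroup of the matrices that are lower triangular modulo `q`. -/
def IsRepsRightQuotient (q : ℕ) (𝒢 : Finset SL(2, ℤ)) : Prop :=
  ∀ E : SL(2, ℤ), ∃! G, G ∈ 𝒢 ∧ IsLowerMod q (G⁻¹ * E)

/-- The shift operator `(f | B(q))(τ) = f(qτ)`. -/
def opB (q : ℕ) (f : Matrix (Fin 2) (Fin 2) ℂ → ℂ) : Matrix (Fin 2) (Fin 2) ℂ → ℂ :=
  fun τ => f ((q : ℂ) • τ)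

/-- The classical Gauss sum `g(q) = ∑_{a mod q} exp(2πi a²/q)`. -/
def gaussSumQ (q : ℕ) : ℂ :=
  ∑ a ∈ Finset.range q, Complex.exp (2 * Real.pi * Complex.I * (a : ℂ) ^ 2 / q)

/-- The twist `A₀(q)`, computed with the set `𝒢` of coset representatives:
`f | A₀(q) = q⁻¹ ∑_{G, y} f | (ᵗG⁻¹, YG/q; 0, G)` with `Y = (y, 0; 0, 0)`, `y` modulo `q`. -/
def opA0 (k : ℤ) (q : ℕ) (𝒢 : Finset SL(2, ℤ)) (f : Matrix (Fin 2) (Fin 2) ℂ → ℂ) :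
    Matrix (Fin 2) (Fin 2) ℂ → ℂ := fun τ =>
  (q : ℂ)⁻¹ * ∑ G ∈ 𝒢, ∑ y ∈ Finset.range q,
    slash k (fromBlocks ((ratMat G)ᵀ⁻¹) ((q : ℚ)⁻¹ • (symMat (y : ℚ) 0 0 * ratMat G))
      0 (ratMat G)) f τ

/-- The twist `A₁(q)`, computed with the set `𝒢` of coset representatives:
`f | A₁(q) = (q² g(q))⁻¹ ∑_{G, Y} (y₁/q) f | (G⁻¹, Y ᵗG/q; 0, ᵗG)`, with `Y = (y₁, y₂; y₂, y₄)`
running over the integral symmetric matrices modulo `q`. -/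
def opA1 (k : ℤ) (q : ℕ) [Fact q.Prime] (𝒢 : Finset SL(2, ℤ))
    (f : Matrix (Fin 2) (Fin 2) ℂ → ℂ) : Matrix (Fin 2) (Fin 2) ℂ → ℂ := fun τ =>
  ((q : ℂ) ^ 2 * gaussSumQ q)⁻¹ *
    ∑ G ∈ 𝒢, ∑ y₁ ∈ Finset.range q, ∑ y₂ ∈ Finset.range q, ∑ y₄ ∈ Finset.range q,
      (legendreSym q (y₁ : ℤ) : ℂ) *
        slash k (fromBlocks ((ratMat G)⁻¹)
          ((q : ℚ)⁻¹ • (symMat (y₁ : ℚ) y₂ y₄ * (ratMat G)ᵀ)) 0 (ratMat G)ᵀ) f τ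

/-- The twist `A₂(q)`: `f | A₂(q) = q⁻¹ (-1/q) ∑_Y (det Y/q) f | (I, Y/q; 0, I)`, with `Y` running
over the integral symmetric matrices modulo `q`. -/
def opA2 (k : ℤ) (q : ℕ) [Fact q.Prime] (f : Matrix (Fin 2) (Fin 2) ℂ → ℂ) :
    Matrix (Fin 2) (Fin 2) ℂ → ℂ := fun τ =>
  (q : ℂ)⁻¹ * (legendreSym q (-1) : ℂ) *
    ∑ y₁ ∈ Finset.range q, ∑ y₂ ∈ Finset.range q, ∑ y₄ ∈ Finset.range q,
      (legendreSym q (symMat (y₁ : ℤ) y₂ y₄).det : ℂ) *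
        slash k (fromBlocks 1 ((q : ℚ)⁻¹ • symMat (y₁ : ℚ) y₂ y₄) 0 1) f τ

/-- `T ≃ ⟨a, b⟩ (q)`: there is `G ∈ GL₂(𝔽_q)` with `ᵗG T G` equal to the diagonal matrix with
entries `a, b`. -/
def IsometricMod (q : ℕ) (T : Matrix (Fin 2) (Fin 2) ℤ) (a b : ZMod q) : Prop :=
  ∃ G : GL (Fin 2) (ZMod q),
    (G : Matrix (Fin 2) (Fin 2) (ZMod q))ᵀ * T.map (Int.cast : ℤ → ZMod q) * G = diagonal ![a, b]

/-- `T` modulo `q` is a hyperbolic plane `⟨1, -1⟩`. -/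
def IsHyperbolicMod (q : ℕ) (T : Matrix (Fin 2) (Fin 2) ℤ) : Prop := IsometricMod q T 1 (-1)

/-- `T` modulo `q` is an anisotropic plane `⟨1, -ω⟩` with `ω` a non-square modulo `q`. -/
def IsAnisotropicMod (q : ℕ) (T : Matrix (Fin 2) (Fin 2) ℤ) : Prop :=
  ∃ ω : ZMod q, ¬ IsSquare ω ∧ IsometricMod q T 1 (-ω)

end SiegelTwist

end

/-! On the upper half space each twist is a weighted sum `∑ w(s) f(τ + s/q)` over the symmetric
matrices `s` modulo `q`. Indeed, slashing by `(ᵗV⁻¹, SV/q; 0, V)` with `det V = 1` gives `f(τ +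
ᵗVSV/q)`, because `f` is invariant under unimodular substitutions (`slash_eq_translate`). The first
row of `G` identifies `L \ SL₂(ℤ)` with the projective line over `𝔽_q`, so a sum over cosets is
`1/(q-1)` times a sum over nonzero vectors `v` (`sum_repsLeft`), whatever the representatives. Up to
constants, the weight of `A₀` counts the ways to write `s = y ᵗv v`, that of `A₁` sums the quadratic
character of the values `s(v)`, and that of `A₂` is the quadratic character of `det s`. All three
are invariant under `s ↦ ᵗDsD` for `D` in `GL₂(𝔽_q)`.

Modularity: if `q² ∣ C`, translating by `S/q` after `γ` and by `-ᵗDSD/q` before it gives an integral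
symplectic matrix with the same `C`. Its lower right block is congruent to `D` modulo `cond χ` once
`q · cond χ ∣ C`. So `γ` carries the translate by `s` to the translate by `ᵗDsD`, with the
automorphy factor of `f` (`transform_translate`), and the invariance of `w` allows the sum to be
reindexed. For `B(q)` it suffices to conjugate `γ` by a scaling.

Fourier coefficients: translation by `s/q` multiplies `c(T)` by the additive character of `½ Tr(Ts)`
(`coeffAt_translate`), so the twist multiplies `c(T)` by the Fourier transform `symHat w` at `T`
modulo `q`. The transform inherits the invariance of `w`. As `q` is odd, `T` may be taken diagonal
modulo `q`; there the transform is the number of isotropic lines for `A₀` and comes from Gauss sums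
for `A₁` and `A₂`. -/

noncomputable section
namespace SiegelTwist

/-! ### Symmetric matrices as triples -/

section Congruence

variable {R : Type*} [CommRing R]

/-- The symmetric matrix with the entries of a triple. -/
def symOf (s : R × R × R) : Matrix (Fin 2) (Fin 2) R := symMat s.1 s.2.1 s.2.2

/-- The action `S ↦ ᵗD S D` on symmetric matrices. -/
def congrSym (D : Matrix (Fin 2) (Fin 2) R) (s : R × R × R) : R × R × R :=
  (D 0 0 ^ 2 * s.1 + 2 * (D 0 0 * D 1 0) * s.2.1 + D 1 0 ^ 2 * s.2.2,
    D 0 0 * D 0 1 * s.1 + (D 0 0 * D 1 1 + D 0 1 * D 1 0) * s.2.1 + D 1 0 * D 1 1 * s.2.2,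
    D 0 1 ^ 2 * s.1 + 2 * (D 0 1 * D 1 1) * s.2.1 + D 1 1 ^ 2 * s.2.2)

lemma symOf_congrSym (D : Matrix (Fin 2) (Fin 2) R) (s : R × R × R) :
    symOf (congrSym D s) = Dᵀ * symOf s * D := by
  ext i j
  fin_cases i <;> fin_cases j <;>
    simp [symOf, symMat, congrSym, Matrix.mul_apply, Fin.sum_univ_two] <;> ring

omit [CommRing R] in
lemma symOf_injective : Function.Injective (symOf : R × R × R → Matrix (Fin 2) (Fin 2) R) := by
  rintro ⟨a, b, c⟩ ⟨a', b', c'⟩ h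
  have h0 := congrFun (congrFun h 0) 0
  have h1 := congrFun (congrFun h 0) 1
  have h2 := congrFun (congrFun h 1) 1
  simp only [symOf, symMat, of_apply, cons_val', cons_val_zero, cons_val_fin_one,
    cons_val_one] at h0 h1 h2
  simp [h0, h1, h2]

lemma congrSym_mul (D E : Matrix (Fin 2) (Fin 2) R) (s : R × R × R) :
    congrSym (D * E) s = congrSym E (congrSym D s) := by
  apply symOf_injective
  simp only [symOf_congrSym, Matrix.transpose_mul, Matrix.mul_assoc]

lemma congrSym_one (s : R × R × R) : congrSym (1 : Matrix (Fin 2) (Fin 2) R) s = s := by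
  apply symOf_injective
  simp [symOf_congrSym]

/-- The action of an invertible matrix on symmetric matrices as a bijection. -/
def congrEquiv (D E : Matrix (Fin 2) (Fin 2) R) (h : D * E = 1) (h' : E * D = 1) :
    R × R × R ≃ R × R × R where
  toFun := congrSym D
  invFun := congrSym E
  left_inv s := by rw [← congrSym_mul, h, congrSym_one]
  right_inv s := by rw [← congrSym_mul, h', congrSym_one]

omit [CommRing R] in
lemma symOf_entries {T : Matrix (Fin 2) (Fin 2) R} (hT : T.IsSymm) :
    symOf (T 0 0, T 0 1, T 1 1) = T := by
  ext i j
  fin_cases i <;> fin_cases j <;> simp [symOf, symMat]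
  exact hT.apply 1 0

lemma congrSym_map {S : Type*} [CommRing S] (φ : R →+* S) (D : Matrix (Fin 2) (Fin 2) R)
    (s : R × R × R) :
    congrSym (D.map φ) (φ s.1, φ s.2.1, φ s.2.2) =
      (φ (congrSym D s).1, φ (congrSym D s).2.1, φ (congrSym D s).2.2) := by
  simp [congrSym, map_ofNat]

end Congruence

/-! ### Character sums over symmetric matrices modulo `q` -/

section CharacterSums

variable (q : ℕ) [Fact q.Prime]

/-- The quadratic character modulo `q` with complex values. -/
def quadChar : MulChar (ZMod q) ℂ :=
  (quadraticChar (ZMod q)).ringHomComp (Int.castRingHom ℂ)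

/-- The quadratic Gauss sum modulo `q`. -/
def quadGauss : ℂ := gaussSum (quadChar q) (ZMod.stdAddChar (N := q))

variable {q}

lemma quadChar_intCast (a : ℤ) : quadChar q (a : ZMod q) = (legendreSym q a : ℂ) := by
  simp [quadChar, legendreSym]

lemma quadChar_zero : quadChar q 0 = 0 :=
  MulChar.map_nonunit _ not_isUnit_zero

lemma quadChar_sq {a : ZMod q} (ha : a ≠ 0) : quadChar q a ^ 2 = 1 := by
  simp only [quadChar, MulChar.ringHomComp_apply]
  rw [← map_pow, quadraticChar_sq_one ha, map_one]

lemma quadChar_mul_self {a : ZMod q} (ha : a ≠ 0) : quadChar q a * quadChar q a = 1 := by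
  rw [← sq, quadChar_sq ha]

lemma quadChar_sq_mul {a : ZMod q} (ha : a ≠ 0) (b : ZMod q) :
    quadChar q (a ^ 2 * b) = quadChar q b := by
  rw [map_mul, map_pow, quadChar_sq ha, one_mul]

section Odd

variable (hq : q ≠ 2)
include hq

lemma quadChar_ne_one : quadChar q ≠ 1 := by
  have h := quadraticChar_ne_one (F := ZMod q) (by rwa [ZMod.ringChar_zmod_n])
  rw [quadChar]
  exact (MulChar.ringHomComp_ne_one_iff (by exact Int.cast_injective)).mpr h

omit hq in
lemma quadChar_isQuadratic : (quadChar q).IsQuadratic :=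
  (quadraticChar_isQuadratic (ZMod q)).comp _

lemma quadGauss_sq : quadGauss q ^ 2 = quadChar q (-1) * q := by
  have h := gaussSum_sq (quadChar_ne_one hq) quadChar_isQuadratic (ZMod.isPrimitive_stdAddChar q)
  rw [ZMod.card] at h
  exact h

lemma quadGauss_ne_zero : quadGauss q ≠ 0 := by
  intro h
  have h2 := quadGauss_sq hq
  rw [h] at h2
  have hq0 : (q : ℂ) ≠ 0 := by exact_mod_cast (Fact.out : q.Prime).ne_zero
  have h1 := quadChar_sq (q := q) (a := -1) (by simp)
  rcases mul_eq_zero.mp (h2.symm.trans (by simp)) with h3 | h3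
  · rw [h3] at h1; simp at h1
  · exact hq0 h3

lemma sum_quadChar : ∑ x : ZMod q, quadChar q x = 0 :=
  MulChar.sum_eq_zero_of_ne_one (quadChar_ne_one hq)

/-- The case `c = 0` is consistent: both sides vanish because the character is nontrivial. -/
lemma sum_quadChar_mul_stdAddChar (c : ZMod q) :
    ∑ x : ZMod q, quadChar q x * ZMod.stdAddChar (c * x) = quadChar q c * quadGauss q := by
  by_cases hc : c = 0
  · subst hc
    simp [sum_quadChar hq, quadChar_zero]
  · have h := gaussSum_mulShift (quadChar q) (ZMod.stdAddChar (N := q)) (Units.mk0 c hc)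
    rw [← quadGauss, Units.val_mk0] at h
    rw [← h, ← mul_assoc, quadChar_mul_self hc, one_mul]
    simp [gaussSum, AddChar.mulShift_apply]

omit hq in
lemma sum_stdAddChar_mul (c : ZMod q) :
    ∑ x : ZMod q, ZMod.stdAddChar (c * x) = if c = 0 then (q : ℂ) else 0 := by
  have h := AddChar.sum_mulShift c (ZMod.isPrimitive_stdAddChar q)
  simp only [mul_comm _ c, ZMod.card] at h
  rw [h]
  split_ifs <;> simp

lemma sum_stdAddChar_mul_sq {c : ZMod q} (hc : c ≠ 0) :
    ∑ x : ZMod q, ZMod.stdAddChar (c * x ^ 2) = quadChar q c * quadGauss q := by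
  classical
  -- The fibre of squaring over `y` has `1 + (y/q)` elements; the constant `1` contributes a full
  -- additive character sum, which vanishes.
  have h1 : ∀ y : ZMod q, ((Finset.univ.filter fun x : ZMod q => x ^ 2 = y).card : ℂ)
      = quadChar q y + 1 := by
    intro y
    have h := quadraticChar_card_sqrts (F := ZMod q) (by rwa [ZMod.ringChar_zmod_n]) y
    have h2 : {x : ZMod q | x ^ 2 = y}.toFinset = Finset.univ.filter fun x => x ^ 2 = y := by
      ext; simp
    rw [h2] at h
    have h3 := congrArg (Int.cast : ℤ → ℂ) h
    push_cast at h3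
    rw [h3]
    simp [quadChar]
  calc ∑ x : ZMod q, ZMod.stdAddChar (c * x ^ 2)
      = ∑ y : ZMod q, ∑ x ∈ Finset.univ.filter (fun x : ZMod q => x ^ 2 = y),
          ZMod.stdAddChar (c * x ^ 2) :=
        (Finset.sum_fiberwise (Finset.univ : Finset (ZMod q)) (fun x => x ^ 2) _).symm
    _ = ∑ y : ZMod q, (quadChar q y + 1) * ZMod.stdAddChar (c * y) := by
        refine Finset.sum_congr rfl fun y _ => ?_
        rw [← h1, ← nsmul_eq_mul, ← Finset.sum_const]
        refine Finset.sum_congr rfl fun x hx => ?_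
        rw [(Finset.mem_filter.mp hx).2]
    _ = quadChar q c * quadGauss q := by
        simp only [add_mul, one_mul, Finset.sum_add_distrib, sum_quadChar_mul_stdAddChar hq,
          sum_stdAddChar_mul, if_neg hc, add_zero]

/-- The sum of the quadratic character over the values of a nonconstant affine function. -/
lemma sum_quadChar_affine {c : ZMod q} (hc : c ≠ 0) (d : ZMod q) :
    ∑ x : ZMod q, quadChar q (c * x + d) = 0 := by
  rw [← sum_quadChar hq]
  exact Fintype.sum_bijective (fun x => c * x + d)
    ((Equiv.addRight d).bijective.comp (mulLeft_bijective₀ c hc)) _ _ fun _ => rfl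

omit hq in
lemma sum_range_eq_sum_zmod (h : ZMod q → ℂ) :
    ∑ y ∈ Finset.range q, h (y : ZMod q) = ∑ y : ZMod q, h y := by
  refine Finset.sum_bij (fun y _ => (y : ZMod q)) (by simp) ?_ ?_ (by simp)
  · intro a ha b hb hab
    rw [ZMod.natCast_eq_natCast_iff', Nat.mod_eq_of_lt (Finset.mem_range.mp ha),
      Nat.mod_eq_of_lt (Finset.mem_range.mp hb)] at hab
    exact hab
  · intro b _
    exact ⟨b.val, Finset.mem_range.mpr (ZMod.val_lt b), by simp⟩

lemma gaussSumQ_eq : gaussSumQ q = quadGauss q := by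
  have h := sum_stdAddChar_mul_sq hq (one_ne_zero : (1 : ZMod q) ≠ 0)
  rw [map_one, one_mul] at h
  rw [← h, ← sum_range_eq_sum_zmod, gaussSumQ]
  refine Finset.sum_congr rfl fun a _ => ?_
  have := ZMod.stdAddChar_coe (N := q) ((a : ℤ) ^ 2)
  push_cast at this
  rw [one_mul, this]

end Odd

/-- The pairing `½ Tr(T S)` of symmetric matrices modulo `q`. -/
def symPair (t s : ZMod q × ZMod q × ZMod q) : ZMod q :=
  2⁻¹ * (t.1 * s.1 + 2 * t.2.1 * s.2.1 + t.2.2 * s.2.2)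

/-- The trace is cyclic: `Tr(ᵗDTD S) = Tr(T DSᵗD)`. -/
lemma symPair_congrSym (D : Matrix (Fin 2) (Fin 2) (ZMod q)) (t s : ZMod q × ZMod q × ZMod q) :
    symPair (congrSym D t) s = symPair t (congrSym Dᵀ s) := by
  simp only [symPair, congrSym, transpose_apply]
  ring

/-- The Fourier transform of a function on the symmetric matrices modulo `q`. -/
def symHat (w : ZMod q × ZMod q × ZMod q → ℂ) (t : ZMod q × ZMod q × ZMod q) : ℂ :=
  ∑ s, w s * ZMod.stdAddChar (symPair t s)

/-- Invariance under all changes of basis modulo `q`. -/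
def IsCongrInvariant (w : ZMod q × ZMod q × ZMod q → ℂ) : Prop :=
  ∀ D : Matrix (Fin 2) (Fin 2) (ZMod q), IsUnit D → ∀ s, w (congrSym D s) = w s

/-- The adjoint action permutes the summation variable and preserves the weight. This is what
reduces the evaluation to diagonal forms. -/
lemma symHat_congrSym {w : ZMod q × ZMod q × ZMod q → ℂ} (hw : IsCongrInvariant w)
    {D : Matrix (Fin 2) (Fin 2) (ZMod q)} (hD : IsUnit D) (t : ZMod q × ZMod q × ZMod q) :
    symHat w (congrSym D t) = symHat w t := by
  have hdet : IsUnit Dᵀ.det := by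
    rw [det_transpose]
    exact (Matrix.isUnit_iff_isUnit_det D).mp hD
  simp only [symHat, symPair_congrSym]
  refine Fintype.sum_equiv (congrEquiv Dᵀ Dᵀ⁻¹ (Matrix.mul_nonsing_inv _ hdet)
    (Matrix.nonsing_inv_mul _ hdet)) _ _ fun s => ?_
  change _ = w (congrSym Dᵀ s) * ZMod.stdAddChar (symPair t (congrSym Dᵀ s))
  rw [hw _ ((Matrix.isUnit_iff_isUnit_det _).mpr hdet)]

/-- The weight of the twist `A₀`. -/
def weight0 (q : ℕ) [Fact q.Prime] (s : ZMod q × ZMod q × ZMod q) : ℂ :=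
  ((q : ℂ) * (q - 1))⁻¹ * ∑ v ∈ Finset.univ.erase (0 : ZMod q × ZMod q), ∑ y : ZMod q,
    if (y * v.1 ^ 2, y * (v.1 * v.2), y * v.2 ^ 2) = s then 1 else 0

/-- The weight of the twist `A₁`. -/
def weight1 (q : ℕ) [Fact q.Prime] (s : ZMod q × ZMod q × ZMod q) : ℂ :=
  ((q : ℂ) ^ 2 * quadGauss q * (q - 1))⁻¹ * ∑ v : ZMod q × ZMod q,
    quadChar q (v.1 ^ 2 * s.1 + 2 * (v.1 * v.2) * s.2.1 + v.2 ^ 2 * s.2.2)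

/-- The weight of the twist `A₂`. -/
def weight2 (q : ℕ) [Fact q.Prime] (s : ZMod q × ZMod q × ZMod q) : ℂ :=
  (q : ℂ)⁻¹ * quadChar q (-1) * quadChar q (s.1 * s.2.2 - s.2.1 ^ 2)

/-- The bijection of the plane given by an invertible matrix. -/
def planeEquiv {D : Matrix (Fin 2) (Fin 2) (ZMod q)} (hD : D.det ≠ 0) :
    ZMod q × ZMod q ≃ ZMod q × ZMod q where
  toFun v := (D 0 0 * v.1 + D 1 0 * v.2, D 0 1 * v.1 + D 1 1 * v.2)
  invFun v := (D.det⁻¹ * (D 1 1 * v.1 - D 1 0 * v.2), D.det⁻¹ * (-D 0 1 * v.1 + D 0 0 * v.2))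
  left_inv v := by
    ext <;> simp only <;> rw [inv_mul_eq_iff_eq_mul₀ hD, det_fin_two] <;> ring
  right_inv v := by
    have h := inv_mul_cancel₀ hD
    rw [det_fin_two] at h ⊢
    ext <;> simp only
    · linear_combination v.1 * h
    · linear_combination v.2 * h

lemma det_ne_zero_of_isUnit {D : Matrix (Fin 2) (Fin 2) (ZMod q)} (hD : IsUnit D) : D.det ≠ 0 :=
  ((Matrix.isUnit_iff_isUnit_det D).mp hD).ne_zero

/-- The determinant of `s` is multiplied by the square `(det D)²`, which the quadratic character
ignores. -/
lemma isCongrInvariant_weight2 : IsCongrInvariant (weight2 q) := by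
  intro D hD s
  simp only [weight2]
  congr 1
  rw [← quadChar_sq_mul (det_ne_zero_of_isUnit hD) (s.1 * s.2.2 - s.2.1 ^ 2)]
  congr 1
  simp only [congrSym, det_fin_two]
  ring

/-- The value of `ᵗDsD` at `v` is the value of `s` at `Dv`, and `v ↦ Dv` permutes the plane. -/
lemma isCongrInvariant_weight1 : IsCongrInvariant (weight1 q) := by
  intro D hD s
  simp only [weight1]
  congr 1
  have hdet : Dᵀ.det ≠ 0 := by rw [det_transpose]; exact det_ne_zero_of_isUnit hD
  refine Fintype.sum_equiv (planeEquiv hdet) _ _ fun v => ?_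
  simp only [planeEquiv, Equiv.coe_fn_mk, transpose_apply, congrSym]
  congr 1
  ring

/-- The rank one matrix of `v` scaled by `y` goes to that of `ᵗDv`, scaled by the same `y`. -/
lemma isCongrInvariant_weight0 : IsCongrInvariant (weight0 q) := by
  intro D hD s
  have hdet := det_ne_zero_of_isUnit hD
  have hdet' : IsUnit D.det := (Matrix.isUnit_iff_isUnit_det D).mp hD
  simp only [weight0]
  congr 1
  symm
  refine Finset.sum_equiv (planeEquiv hdet) (fun v => ?_) fun v _ => ?_
  · have h0 : planeEquiv hdet 0 = 0 := by simp [planeEquiv]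
    simp only [Finset.mem_erase, Finset.mem_univ, and_true]
    rw [← h0, (planeEquiv hdet).injective.ne_iff, h0]
  · refine Finset.sum_congr rfl fun y _ => ?_
    have key : (y * (planeEquiv hdet v).1 ^ 2, y * ((planeEquiv hdet v).1 * (planeEquiv hdet v).2),
        y * (planeEquiv hdet v).2 ^ 2) =
        congrSym D (y * v.1 ^ 2, y * (v.1 * v.2), y * v.2 ^ 2) := by
      simp only [planeEquiv, Equiv.coe_fn_mk, congrSym, Prod.mk.injEq]
      refine ⟨?_, ?_, ?_⟩ <;> ring
    rw [key]
    have hinj := (congrEquiv D D⁻¹ (Matrix.mul_nonsing_inv _ hdet')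
      (Matrix.nonsing_inv_mul _ hdet')).injective.eq_iff
        (a := (y * v.1 ^ 2, y * (v.1 * v.2), y * v.2 ^ 2)) (b := s)
    exact if_congr hinj.symm rfl rfl

lemma sum_weight0_mul (Φ : ZMod q × ZMod q × ZMod q → ℂ) :
    ∑ s, weight0 q s * Φ s = ((q : ℂ) * (q - 1))⁻¹ *
      ∑ v ∈ Finset.univ.erase (0 : ZMod q × ZMod q), ∑ y : ZMod q,
        Φ (y * v.1 ^ 2, y * (v.1 * v.2), y * v.2 ^ 2) := by
  simp only [weight0, mul_assoc, ← Finset.mul_sum, Finset.sum_mul]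
  congr 1
  rw [Finset.sum_comm]
  refine Finset.sum_congr rfl fun v _ => ?_
  rw [Finset.sum_comm]
  refine Finset.sum_congr rfl fun y _ => ?_
  simp only [ite_mul, one_mul, zero_mul, Finset.sum_ite_eq, Finset.mem_univ, if_true]

end CharacterSums

/-! ### Fourier transforms of the three weights at diagonal forms -/

section Evaluation

variable {q : ℕ} [Fact q.Prime]

lemma two_ne_zero_zmod (hq : q ≠ 2) : (2 : ZMod q) ≠ 0 := by
  intro h
  have h2 : ((2 : ℕ) : ZMod q) = 0 := by exact_mod_cast h
  rw [ZMod.natCast_eq_zero_iff] at h2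
  exact hq ((Nat.prime_dvd_prime_iff_eq Fact.out Nat.prime_two).mp h2)

lemma natCast_prime_ne_zero (q : ℕ) [Fact q.Prime] : (q : ℂ) ≠ 0 := by
  exact_mod_cast (Fact.out : q.Prime).ne_zero

lemma natCast_prime_sub_one_ne_zero (q : ℕ) [Fact q.Prime] : (q : ℂ) - 1 ≠ 0 := by
  rw [sub_ne_zero]
  exact_mod_cast (Fact.out : q.Prime).one_lt.ne'

lemma card_erase_zero (q : ℕ) [Fact q.Prime] :
    ((Finset.univ.erase (0 : ZMod q)).card : ℂ) = q - 1 := by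
  rw [Finset.card_erase_of_mem (Finset.mem_univ _), Finset.card_univ, ZMod.card,
    Nat.cast_sub (Fact.out : q.Prime).one_lt.le, Nat.cast_one]

/-- The zeros of a diagonal form determine the Fourier transform of the weight of `A₀`. -/
lemma symHat_weight0 (hq : q ≠ 2) (a b : ZMod q) :
    symHat (weight0 q) (a, 0, b) = ((q : ℂ) - 1)⁻¹ *
      (((Finset.univ.erase (0 : ZMod q × ZMod q)).filter
        fun v => a * v.1 ^ 2 + b * v.2 ^ 2 = 0).card : ℂ) := by
  have h2 := two_ne_zero_zmod hq
  have hq0 := natCast_prime_ne_zero q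
  rw [symHat, sum_weight0_mul, mul_inv, mul_assoc, mul_left_comm]
  congr 1
  rw [inv_mul_eq_iff_eq_mul₀ hq0, Finset.card_filter, Nat.cast_sum, Finset.mul_sum]
  refine Finset.sum_congr rfl fun v _ => ?_
  have h : ∀ y : ZMod q, symPair (a, 0, b) (y * v.1 ^ 2, y * (v.1 * v.2), y * v.2 ^ 2) =
      2⁻¹ * (a * v.1 ^ 2 + b * v.2 ^ 2) * y := by
    intro y
    simp only [symPair]
    ring
  simp only [h, sum_stdAddChar_mul, mul_eq_zero, inv_eq_zero, h2, false_or]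
  split_ifs <;> simp

/-- The form `x² - y²` has exactly two isotropic lines, `y = x` and `y = -x`, distinct because `q`
is odd. -/
lemma symHat_weight0_hyperbolic (hq : q ≠ 2) : symHat (weight0 q) (1, 0, -1) = 2 := by
  rw [symHat_weight0 hq, inv_mul_eq_iff_eq_mul₀ (natCast_prime_sub_one_ne_zero q)]
  have h2 := two_ne_zero_zmod hq
  have hset : ((Finset.univ.erase (0 : ZMod q × ZMod q)).filter
      fun v => 1 * v.1 ^ 2 + -1 * v.2 ^ 2 = 0) =
      (Finset.univ.erase (0 : ZMod q)).image (fun x => (x, x)) ∪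
        (Finset.univ.erase (0 : ZMod q)).image (fun x => (x, -x)) := by
    ext ⟨x, y⟩
    simp only [Finset.mem_filter, Finset.mem_erase, Finset.mem_univ, and_true, Finset.mem_union,
      Finset.mem_image, Prod.mk.injEq, ne_eq, Prod.mk_eq_zero]
    constructor
    · rintro ⟨h0, h⟩
      have h' : (x - y) * (x + y) = 0 := by linear_combination h
      rcases mul_eq_zero.mp h' with h1 | h1
      · have : y = x := by linear_combination -h1
        subst this
        exact Or.inl ⟨y, fun h3 => h0 ⟨h3, h3⟩, rfl, rfl⟩
      · have : y = -x := by linear_combination h1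
        subst this
        exact Or.inr ⟨x, fun h3 => h0 ⟨h3, by rw [h3, neg_zero]⟩, rfl, rfl⟩
    · rintro (⟨z, hz, rfl, rfl⟩ | ⟨z, hz, rfl, rfl⟩)
      · exact ⟨fun h => hz h.1, by ring⟩
      · exact ⟨fun h => hz h.1, by ring⟩
  rw [hset, Finset.card_union_of_disjoint, Finset.card_image_of_injective,
    Finset.card_image_of_injective, Nat.cast_add, card_erase_zero]
  · ring
  · intro x y h; exact (Prod.mk.inj h).1
  · intro x y h; exact (Prod.mk.inj h).1
  · rw [Finset.disjoint_left]
    simp only [Finset.mem_image, Finset.mem_erase, Finset.mem_univ, and_true, not_exists, not_and]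
    rintro _ ⟨x, hx, rfl⟩ y hy h
    obtain ⟨rfl, h⟩ := Prod.mk.inj h
    exact hx ((mul_eq_zero.mp (by linear_combination -h : 2 * y = 0)).resolve_left h2)

/-- A nonzero solution of `x² = ωy²` has `y ≠ 0` and makes `ω = (x/y)²` a square. -/
lemma symHat_weight0_anisotropic (hq : q ≠ 2) {ω : ZMod q} (hω : ¬ IsSquare ω) :
    symHat (weight0 q) (1, 0, -ω) = 0 := by
  rw [symHat_weight0 hq, Finset.card_eq_zero.mpr, Nat.cast_zero, mul_zero]
  refine Finset.filter_eq_empty_iff.mpr ?_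
  rintro ⟨x, y⟩ hv h
  simp only at h
  by_cases hy : y = 0
  · subst hy
    have hx : x = 0 := by simpa using h
    simp [hx] at hv
  · refine hω ⟨x / y, ?_⟩
    field_simp
    linear_combination -h

/-- The radical is the only isotropic line. -/
lemma symHat_weight0_rank_one (hq : q ≠ 2) {μ : ZMod q} (hμ : μ ≠ 0) :
    symHat (weight0 q) (0, 0, μ) = 1 := by
  rw [symHat_weight0 hq, inv_mul_eq_iff_eq_mul₀ (natCast_prime_sub_one_ne_zero q)]
  have hset : ((Finset.univ.erase (0 : ZMod q × ZMod q)).filter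
      fun v => 0 * v.1 ^ 2 + μ * v.2 ^ 2 = 0) =
      (Finset.univ.erase (0 : ZMod q)).image (fun x => (x, 0)) := by
    ext ⟨x, y⟩
    simp only [Finset.mem_filter, Finset.mem_erase, Finset.mem_univ, and_true, Finset.mem_image,
      Prod.mk.injEq, ne_eq, Prod.mk_eq_zero, zero_mul, zero_add, mul_eq_zero, hμ, false_or,
      pow_eq_zero_iff two_ne_zero]
    constructor
    · rintro ⟨h0, rfl⟩
      exact ⟨x, fun h => h0 ⟨h, rfl⟩, rfl, rfl⟩
    · rintro ⟨z, hz, rfl, rfl⟩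
      exact ⟨fun h => hz h.1, rfl⟩
  rw [hset, Finset.card_image_of_injective _ fun x y h => (Prod.mk.inj h).1, card_erase_zero,
    mul_one]

lemma symHat_weight0_zero (hq : q ≠ 2) : symHat (weight0 q) (0, 0, 0) = q + 1 := by
  rw [symHat_weight0 hq, inv_mul_eq_iff_eq_mul₀ (natCast_prime_sub_one_ne_zero q)]
  rw [Finset.filter_true_of_mem (fun v _ => by ring), Finset.card_erase_of_mem (Finset.mem_univ _),
    Finset.card_univ, Fintype.card_prod, ZMod.card, Nat.cast_sub, Nat.cast_mul]
  · push_cast; ring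
  · exact Nat.one_le_iff_ne_zero.mpr (mul_ne_zero (NeZero.ne q) (NeZero.ne q))

/-- For a fixed `v` off both coordinate axes the sum over the off-diagonal entry vanishes. On an
axis, one diagonal entry of `s` gives a Gauss sum, the off-diagonal entry gives `q`, and the other
diagonal entry gives `q` or `0` according to whether its coefficient is zero. -/
lemma symHat_weight1 (hq : q ≠ 2) (a b : ZMod q) :
    symHat (weight1 q) (a, 0, b) =
      (if b = 0 then quadChar q (2⁻¹ * a) else 0) +
        (if a = 0 then quadChar q (2⁻¹ * b) else 0) := by
  have h2 := two_ne_zero_zmod hq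
  have h2' := inv_ne_zero h2
  have hq0 := natCast_prime_ne_zero q
  have hq1 := natCast_prime_sub_one_ne_zero q
  have hg := quadGauss_ne_zero hq
  have inner : ∀ v : ZMod q × ZMod q, (∑ s : ZMod q × ZMod q × ZMod q,
      quadChar q (v.1 ^ 2 * s.1 + 2 * (v.1 * v.2) * s.2.1 + v.2 ^ 2 * s.2.2) *
        ZMod.stdAddChar (symPair (a, 0, b) s)) =
      (if v.2 = 0 then if v.1 = 0 then 0 else
        (if b = 0 then (q : ℂ) ^ 2 * quadGauss q * quadChar q (2⁻¹ * a) else 0) else 0) +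
      (if v.1 = 0 then if v.2 = 0 then 0 else
        (if a = 0 then (q : ℂ) ^ 2 * quadGauss q * quadChar q (2⁻¹ * b) else 0) else 0) := by
    rintro ⟨x, y⟩
    simp only [Fintype.sum_prod_type, symPair, mul_zero, zero_mul, add_zero]
    by_cases hx : x = 0
    · subst hx
      by_cases hy : y = 0
      · subst hy
        simp [quadChar_zero]
      · have hterm : ∀ s₁ s₂ s₄ : ZMod q,
            quadChar q (0 ^ 2 * s₁ + 2 * (0 * y) * s₂ + y ^ 2 * s₄) *
              ZMod.stdAddChar (2⁻¹ * (a * s₁ + b * s₄)) =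
            ZMod.stdAddChar (2⁻¹ * a * s₁) * (quadChar q s₄ * ZMod.stdAddChar (2⁻¹ * b * s₄)) := by
          intro s₁ s₂ s₄
          rw [show 0 ^ 2 * s₁ + 2 * (0 * y) * s₂ + y ^ 2 * s₄ = y ^ 2 * s₄ by ring,
            quadChar_sq_mul hy, mul_add, AddChar.map_add_eq_mul, mul_assoc 2⁻¹ a,
            mul_assoc 2⁻¹ b]
          ring
        simp only [hterm, ← Finset.mul_sum, sum_quadChar_mul_stdAddChar hq, Finset.sum_const,
          Finset.card_univ, ZMod.card, ← Finset.sum_mul, sum_stdAddChar_mul, mul_eq_zero, h2',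
          false_or, hy, if_true, if_false, zero_add, nsmul_eq_mul]
        split_ifs <;> simp; ring
    · by_cases hy : y = 0
      · subst hy
        have hterm : ∀ s₁ s₂ s₄ : ZMod q,
            quadChar q (x ^ 2 * s₁ + 2 * (x * 0) * s₂ + 0 ^ 2 * s₄) *
              ZMod.stdAddChar (2⁻¹ * (a * s₁ + b * s₄)) =
            (quadChar q s₁ * ZMod.stdAddChar (2⁻¹ * a * s₁)) * ZMod.stdAddChar (2⁻¹ * b * s₄) := by
          intro s₁ s₂ s₄
          rw [show x ^ 2 * s₁ + 2 * (x * 0) * s₂ + 0 ^ 2 * s₄ = x ^ 2 * s₁ by ring,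
            quadChar_sq_mul hx, mul_add, AddChar.map_add_eq_mul, mul_assoc 2⁻¹ a,
            mul_assoc 2⁻¹ b]
          ring
        simp only [hterm, ← Finset.mul_sum, sum_stdAddChar_mul, Finset.sum_const,
          Finset.card_univ, ZMod.card, ← Finset.sum_mul, sum_quadChar_mul_stdAddChar hq,
          mul_eq_zero, h2', false_or, hx, if_true, if_false, add_zero, nsmul_eq_mul]
        split_ifs <;> simp; ring
      -- The additive character does not involve `s₂`, while the argument of the quadratic character
      -- is affine in `s₂` with slope `2xy ≠ 0`.
      · have hxy : 2 * (x * y) ≠ 0 := mul_ne_zero h2 (mul_ne_zero hx hy)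
        simp only [hx, hy, if_false, add_zero]
        refine Finset.sum_eq_zero fun s₁ _ => ?_
        rw [Finset.sum_comm]
        refine Finset.sum_eq_zero fun s₄ _ => ?_
        rw [← Finset.sum_mul]
        have := sum_quadChar_affine hq hxy (x ^ 2 * s₁ + y ^ 2 * s₄)
        rw [Finset.sum_congr rfl fun s₂ _ => ?_, this, zero_mul]
        congr 1
        ring
  -- Each axis carries `q - 1` nonzero vectors, which cancels the factor `q - 1` in the
  -- normalization.
  have hcount : ∀ c : ℂ, ∑ x : ZMod q, (if x = 0 then 0 else c) = (q - 1) * c := by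
    intro c
    rw [← card_erase_zero, ← nsmul_eq_mul, ← Finset.sum_const,
      ← Finset.add_sum_erase _ _ (Finset.mem_univ (0 : ZMod q)), if_pos rfl, zero_add]
    exact Finset.sum_congr rfl fun x hx => if_neg (Finset.ne_of_mem_erase hx)
  simp only [symHat, weight1, mul_assoc, Finset.sum_mul, ← Finset.mul_sum]
  rw [Finset.sum_comm]
  simp only [← mul_assoc]
  rw [inv_mul_eq_iff_eq_mul₀ (mul_ne_zero (mul_ne_zero (pow_ne_zero _ hq0) hg) hq1)]
  simp only [mul_assoc] at inner ⊢
  simp only [inner, Fintype.sum_prod_type, Finset.sum_add_distrib, Finset.sum_ite_eq',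
    Finset.mem_univ, if_true]
  have hswap : ∀ (c : ℂ), (∑ x : ZMod q, ∑ y : ZMod q, if x = 0 then if y = 0 then 0 else c else 0)
      = (q - 1) * c := by
    intro c
    rw [Finset.sum_comm, ← hcount]
    exact Finset.sum_congr rfl fun y _ => by simp
  rw [hcount, hswap]
  split_ifs <;> ring

/-- The sum over `s₁`, on which the additive character does not depend, kills every `s₄ ≠ 0`. At `s₄
= 0` the additive character is trivial, so the result is independent of `μ`. -/
lemma symHat_weight2_degenerate (hq : q ≠ 2) (μ : ZMod q) :
    symHat (weight2 q) (0, 0, μ) = q - 1 := by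
  have hq0 := natCast_prime_ne_zero q
  have hm1 := quadChar_mul_self (q := q) (a := -1) (by simp)
  have key : ∀ s₄ : ZMod q, (∑ s₂ : ZMod q, ∑ s₁ : ZMod q, quadChar q (s₁ * s₄ - s₂ ^ 2)) =
      if s₄ = 0 then (q : ℂ) * (quadChar q (-1) * (q - 1)) else 0 := by
    intro s₄
    split_ifs with h
    · subst h
      simp only [mul_zero, zero_sub, Finset.sum_const, Finset.card_univ, ZMod.card, nsmul_eq_mul,
        ← Finset.mul_sum]
      congr 1
      rw [← Finset.add_sum_erase _ _ (Finset.mem_univ (0 : ZMod q)), ← card_erase_zero,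
        mul_comm (quadChar q (-1)), ← nsmul_eq_mul, ← Finset.sum_const]
      simp only [ne_eq, OfNat.ofNat_ne_zero, not_false_eq_true, zero_pow, neg_zero, quadChar_zero,
        zero_add]
      refine Finset.sum_congr rfl fun x hx => ?_
      rw [← quadChar_sq_mul (Finset.ne_of_mem_erase hx) (-1)]
      congr 1; ring
    · refine Finset.sum_eq_zero fun s₂ _ => ?_
      rw [← sum_quadChar_affine hq h (-s₂ ^ 2)]
      exact Finset.sum_congr rfl fun s₁ _ => by congr 1; ring
  have hsum : ∑ s : ZMod q × ZMod q × ZMod q, quadChar q (s.1 * s.2.2 - s.2.1 ^ 2) *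
      ZMod.stdAddChar (symPair (0, 0, μ) s) = (q : ℂ) * (quadChar q (-1) * (q - 1)) := by
    calc _ = ∑ s₄ : ZMod q, (∑ s₂ : ZMod q, ∑ s₁ : ZMod q, quadChar q (s₁ * s₄ - s₂ ^ 2)) *
          ZMod.stdAddChar (2⁻¹ * (μ * s₄)) := by
          simp only [Fintype.sum_prod_type, symPair, mul_zero, zero_mul, zero_add, Finset.sum_mul]
          rw [Finset.sum_comm]
          conv_rhs => rw [Finset.sum_comm]
          exact Finset.sum_congr rfl fun _ _ => Finset.sum_comm
      _ = _ := by simp [key]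
  simp only [symHat, weight2, mul_assoc, ← Finset.mul_sum]
  rw [hsum, inv_mul_eq_iff_eq_mul₀ hq0]
  linear_combination (q : ℂ) * (q - 1) * hm1

/-- For `s₄ ≠ 0` the sums over `s₁` and `s₂` are Gauss sums with the same coefficient `a/(2s₄)`, so
its two quadratic characters cancel and `g²` remains. For `s₄ = 0` the sum over `s₁` vanishes.
Summing the remaining additive character over `s₄ ≠ 0` gives `-1`. -/
lemma symHat_weight2_nondegenerate (hq : q ≠ 2) {a b : ZMod q} (ha : a ≠ 0) (hb : b ≠ 0) :
    symHat (weight2 q) (a, 0, b) = -1 := by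
  have hq0 := natCast_prime_ne_zero q
  have h2' := inv_ne_zero (two_ne_zero_zmod hq)
  have hm1 := quadChar_mul_self (q := q) (a := -1) (by simp)
  have key : ∀ s₄ : ZMod q, (∑ s₂ : ZMod q, ∑ s₁ : ZMod q, quadChar q (s₁ * s₄ - s₂ ^ 2) *
      ZMod.stdAddChar (2⁻¹ * a * s₁)) = if s₄ = 0 then 0 else quadGauss q ^ 2 := by
    intro s₄
    split_ifs with h
    · subst h
      simp [← Finset.mul_sum, sum_stdAddChar_mul, ha, h2']
    · have hc : 2⁻¹ * a / s₄ ≠ 0 := div_ne_zero (mul_ne_zero h2' ha) h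
      have inner : ∀ s₂ : ZMod q, (∑ s₁ : ZMod q, quadChar q (s₁ * s₄ - s₂ ^ 2) *
          ZMod.stdAddChar (2⁻¹ * a * s₁)) = quadChar q (2⁻¹ * a / s₄) * quadGauss q *
            ZMod.stdAddChar (2⁻¹ * a / s₄ * s₂ ^ 2) := by
        intro s₂
        rw [← sum_quadChar_mul_stdAddChar hq, Finset.sum_mul]
        -- The determinant itself becomes the new variable; solving back for `s₁` produces the phase
        -- quadratic in `s₂`.
        refine Fintype.sum_bijective (fun s₁ => s₁ * s₄ + -s₂ ^ 2)
          ((Equiv.addRight (-s₂ ^ 2)).bijective.comp (mulRight_bijective₀ s₄ h)) _ _ fun s₁ => ?_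
        rw [mul_assoc (quadChar q _), ← AddChar.map_add_eq_mul]
        congr 2
        · ring
        · field_simp
          ring
      simp only [inner, ← Finset.mul_sum, sum_stdAddChar_mul_sq hq hc]
      linear_combination quadGauss q ^ 2 * quadChar_mul_self hc
  have hsum : ∑ s : ZMod q × ZMod q × ZMod q, quadChar q (s.1 * s.2.2 - s.2.1 ^ 2) *
      ZMod.stdAddChar (symPair (a, 0, b) s) = -quadGauss q ^ 2 := by
    calc _ = ∑ s₄ : ZMod q, (∑ s₂ : ZMod q, ∑ s₁ : ZMod q, quadChar q (s₁ * s₄ - s₂ ^ 2) *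
            ZMod.stdAddChar (2⁻¹ * a * s₁)) * ZMod.stdAddChar (2⁻¹ * b * s₄) := by
          simp only [Fintype.sum_prod_type, symPair, mul_zero, zero_mul, add_zero, Finset.sum_mul]
          rw [Finset.sum_comm]
          conv_rhs => rw [Finset.sum_comm]
          refine Finset.sum_congr rfl fun s₂ _ => ?_
          rw [Finset.sum_comm]
          refine Finset.sum_congr rfl fun s₄ _ => Finset.sum_congr rfl fun s₁ _ => ?_
          rw [mul_assoc (quadChar q _), ← AddChar.map_add_eq_mul]
          congr 2
          ring
      _ = ∑ s₄ : ZMod q, (quadGauss q ^ 2 * ZMod.stdAddChar (2⁻¹ * b * s₄) -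
            if s₄ = 0 then quadGauss q ^ 2 else 0) := by
          refine Finset.sum_congr rfl fun s₄ _ => ?_
          rw [key]
          split_ifs with h
          · simp [h]
          · ring
      _ = _ := by
          rw [Finset.sum_sub_distrib, ← Finset.mul_sum, sum_stdAddChar_mul,
            if_neg (mul_ne_zero h2' hb)]
          simp
  simp only [symHat, weight2, mul_assoc, ← Finset.mul_sum]
  rw [hsum, inv_mul_eq_iff_eq_mul₀ hq0, quadGauss_sq hq]
  linear_combination -(q : ℂ) * hm1

end Evaluation

/-! ### Reduction of integral matrices modulo `q` -/

section Reduction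

variable {q : ℕ} [Fact q.Prime]

/-- The triple of an integral symmetric matrix modulo `q`. -/
def redSym (q : ℕ) (T : Matrix (Fin 2) (Fin 2) ℤ) : ZMod q × ZMod q × ZMod q :=
  (T 0 0, T 0 1, T 1 1)

lemma symOf_redSym {T : Matrix (Fin 2) (Fin 2) ℤ} (hT : T.IsSymm) :
    symOf (redSym q T) = T.map (Int.cast : ℤ → ZMod q) := by
  have := symOf_entries (T := T.map (Int.cast : ℤ → ZMod q)) (hT.map _)
  simpa [redSym] using this

lemma isometricMod_iff {T : Matrix (Fin 2) (Fin 2) ℤ} (hT : T.IsSymm) {a b : ZMod q} :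
    IsometricMod q T a b ↔
      ∃ G : Matrix (Fin 2) (Fin 2) (ZMod q), IsUnit G ∧ congrSym G (redSym q T) = (a, 0, b) := by
  have hd : diagonal ![a, b] = symOf (a, 0, b) := by
    ext i j; fin_cases i <;> fin_cases j <;> simp [symOf, symMat]
  constructor
  · rintro ⟨G, hG⟩
    refine ⟨G, G.isUnit, symOf_injective ?_⟩
    rw [symOf_congrSym, symOf_redSym hT, ← hd, hG]
  · rintro ⟨G, ⟨G, rfl⟩, h⟩
    refine ⟨G, ?_⟩
    rw [hd, ← h, symOf_congrSym, symOf_redSym hT]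

lemma symHat_of_isometricMod {w : ZMod q × ZMod q × ZMod q → ℂ} (hw : IsCongrInvariant w)
    {T : Matrix (Fin 2) (Fin 2) ℤ} (hT : T.IsSymm) {a b : ZMod q} (h : IsometricMod q T a b) :
    symHat w (redSym q T) = symHat w (a, 0, b) := by
  obtain ⟨G, hG, h⟩ := (isometricMod_iff hT).mp h
  rw [← h, symHat_congrSym hw hG]

lemma isometricMod_swap {T : Matrix (Fin 2) (Fin 2) ℤ} (hT : T.IsSymm) {a b : ZMod q}
    (h : IsometricMod q T a b) : IsometricMod q T b a := by
  rw [isometricMod_iff hT] at h ⊢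
  obtain ⟨G, hG, h⟩ := h
  have hJ : IsUnit (!![0, 1; 1, 0] : Matrix (Fin 2) (Fin 2) (ZMod q)) := by
    rw [Matrix.isUnit_iff_isUnit_det]; simp
  refine ⟨G * !![0, 1; 1, 0], hG.mul hJ, ?_⟩
  rw [congrSym_mul, h]
  simp [congrSym]

/-- Binary quadratic forms over a field of odd characteristic can be diagonalized. -/
lemma exists_isometricMod (hq : q ≠ 2) {T : Matrix (Fin 2) (Fin 2) ℤ} (hT : T.IsSymm) :
    ∃ a b : ZMod q, IsometricMod q T a b := by
  simp only [isometricMod_iff hT, Matrix.isUnit_iff_isUnit_det, isUnit_iff_ne_zero]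
  obtain ⟨x, y, z⟩ := redSym q T
  have h2 := two_ne_zero_zmod hq
  by_cases hx : x = 0
  · by_cases hz : z = 0
    -- Without diagonal entries there is no pivot; the sum and difference of the basis vectors
    -- diagonalize `2yx₁x₂`.
    · refine ⟨2 * y, -2 * y, !![1, 1; 1, -1], ?_, ?_⟩
      · rw [det_fin_two_of]
        intro h
        exact h2 (by linear_combination -h)
      · subst hx hz
        simp [congrSym]
    · refine ⟨x - y ^ 2 / z, z, !![1, 0; -y / z, 1], by simp, ?_⟩
      simp only [congrSym, of_apply, cons_val', cons_val_zero, cons_val_fin_one, cons_val_one,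
        Prod.mk.injEq]
      refine ⟨?_, ?_, ?_⟩ <;> field_simp <;> ring
  · refine ⟨x, z - y ^ 2 / x, !![1, -y / x; 0, 1], by simp, ?_⟩
    simp only [congrSym, of_apply, cons_val', cons_val_zero, cons_val_fin_one, cons_val_one,
        Prod.mk.injEq]
    refine ⟨?_, ?_, ?_⟩ <;> field_simp <;> ring

/-- The first row of an integral matrix modulo `q`. -/
def firstRow (q : ℕ) (G : SL(2, ℤ)) : ZMod q × ZMod q := ((G 0 0 : ℤ), (G 0 1 : ℤ))

lemma firstRow_ne_zero (G : SL(2, ℤ)) : firstRow q G ≠ 0 := by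
  intro h
  have hdet := G.det_coe
  rw [det_fin_two] at hdet
  have h1 := congrArg (Int.cast : ℤ → ZMod q) hdet
  obtain ⟨h2, h3⟩ := Prod.mk.inj h
  push_cast at h1
  rw [h2, h3] at h1
  simp at h1

/-- The upper right entry of `EG⁻¹` is, up to sign, the determinant of the two first rows. Hence a
coset is a point of the projective line. -/
lemma isLowerMod_mul_inv_iff (E G : SL(2, ℤ)) :
    IsLowerMod q (E * G⁻¹) ↔
      (firstRow q E).2 * (firstRow q G).1 = (firstRow q E).1 * (firstRow q G).2 := by
  simp only [IsLowerMod, firstRow]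
  have : (E * G⁻¹) 0 1 = E 0 1 * G 0 0 - E 0 0 * G 0 1 := by
    rw [Matrix.SpecialLinearGroup.coe_mul, Matrix.SpecialLinearGroup.coe_inv, adjugate_fin_two,
      Matrix.mul_apply, Fin.sum_univ_two]
    simp
    ring
  rw [this]
  push_cast
  rw [sub_eq_zero]

/-- Two nonzero proportional vectors of the plane differ by a nonzero scalar. -/
lemma exists_smul_of_proportional {v w : ZMod q × ZMod q} (hv : v ≠ 0) (hw : w ≠ 0)
    (h : v.2 * w.1 = v.1 * w.2) : ∃ c : ZMod q, c ≠ 0 ∧ v = c • w := by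
  obtain ⟨a, b⟩ := v
  obtain ⟨x, y⟩ := w
  simp only at h
  simp only [ne_eq, Prod.mk_eq_zero, Prod.smul_mk, smul_eq_mul, Prod.mk.injEq] at hv hw ⊢
  by_cases hx : x = 0
  · subst hx
    have hy : y ≠ 0 := fun hy => hw ⟨rfl, hy⟩
    have ha : a = 0 := by
      have : a * y = 0 := by rw [← h, mul_zero]
      exact (mul_eq_zero.mp this).resolve_right hy
    subst ha
    have hb : b ≠ 0 := fun hb => hv ⟨rfl, hb⟩
    exact ⟨b / y, div_ne_zero hb hy, by simp, by field_simp⟩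
  · have ha : a ≠ 0 := by
      rintro rfl
      have : b * x = 0 := by rw [h, zero_mul]
      exact hv ⟨rfl, (mul_eq_zero.mp this).resolve_right hx⟩
    exact ⟨a / x, div_ne_zero ha hx, by field_simp, by field_simp; exact h⟩

lemma exists_firstRow {v : ZMod q × ZMod q} (hv : v ≠ 0) :
    ∃ (c : ZMod q) (E : SL(2, ℤ)), c ≠ 0 ∧ v = c • firstRow q E := by
  obtain ⟨a, b⟩ := v
  by_cases ha : a = 0
  · subst ha
    refine ⟨-b, ⟨!![0, -1; 1, 0], by simp⟩, ?_, ?_⟩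
    · intro hb
      exact hv (by simpa using hb)
    · simp [firstRow]
  · refine ⟨a, ⟨!![1, ((b / a).val : ℤ); 0, 1], by simp⟩, ha, ?_⟩
    simp [firstRow]
    field_simp

/-- Summation over `L \ SL₂(ℤ)` amounts to summation over the projective line. -/
lemma sum_repsLeft {𝒢 : Finset SL(2, ℤ)} (h𝒢 : IsRepsLeftQuotient q 𝒢)
    {φ : ZMod q × ZMod q → ℂ} (hφ : ∀ c : ZMod q, c ≠ 0 → ∀ v, φ (c • v) = φ v) :
    ∑ G ∈ 𝒢, φ (firstRow q G) =
      ((q : ℂ) - 1)⁻¹ * ∑ v ∈ Finset.univ.erase (0 : ZMod q × ZMod q), φ v := by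
  rw [eq_inv_mul_iff_mul_eq₀ (natCast_prime_sub_one_ne_zero q), ← card_erase_zero,
    ← nsmul_eq_mul, ← Finset.sum_const, ← Finset.sum_product']
  -- Every nonzero vector is a unique nonzero multiple of the first row of a unique representative.
  refine Finset.sum_bij (fun p _ => p.1 • firstRow q p.2) ?_ ?_ ?_ ?_
  · rintro ⟨c, G⟩ h
    simp only [Finset.mem_product, Finset.mem_erase, Finset.mem_univ, and_true] at h ⊢
    exact smul_ne_zero h.1 (firstRow_ne_zero G)
  · rintro ⟨c, G⟩ h ⟨c', G'⟩ h' heq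
    simp only [Finset.mem_product, Finset.mem_erase, Finset.mem_univ, and_true] at h h' heq
    obtain ⟨e1, e2⟩ := Prod.mk.inj heq
    simp only [smul_eq_mul] at e1 e2
    have hGG : G = G' := by
      refine (h𝒢 G).unique ⟨h.2, ?_⟩ ⟨h'.2, ?_⟩
      · rw [isLowerMod_mul_inv_iff, mul_comm]
      · rw [isLowerMod_mul_inv_iff]
        refine mul_left_cancel₀ h.1 (mul_left_cancel₀ h'.1 ?_)
        linear_combination c' * (firstRow q G').1 * e2 - c' * (firstRow q G').2 * e1
    subst hGG
    have hc : (c - c') • firstRow q G = 0 := by rw [sub_smul, sub_eq_zero]; exact heq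
    rw [smul_eq_zero, or_iff_left (firstRow_ne_zero G), sub_eq_zero] at hc
    rw [hc]
  · intro v hv
    obtain ⟨c, E, hc, rfl⟩ := exists_firstRow (Finset.ne_of_mem_erase hv)
    obtain ⟨G, ⟨hG, hEG⟩, -⟩ := h𝒢 E
    obtain ⟨d, hd, h⟩ := exists_smul_of_proportional (firstRow_ne_zero E) (firstRow_ne_zero G)
      ((isLowerMod_mul_inv_iff E G).mp hEG)
    exact ⟨(c * d, G), by simp [hc, hd, hG], by rw [h, smul_smul]⟩
  · rintro ⟨c, G⟩ h
    simp only [Finset.mem_product, Finset.mem_erase, Finset.mem_univ, and_true] at h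
    exact (hφ c h.1 _).symm

lemma isLowerMod_inv_iff (E : SL(2, ℤ)) : IsLowerMod q E⁻¹ ↔ IsLowerMod q E := by
  simp only [IsLowerMod, Matrix.SpecialLinearGroup.coe_inv, adjugate_fin_two]
  simp

/-- Inversion exchanges the cosets `EL` and `LE⁻¹`, so `A₁` can use the same projective line through
the first rows of the inverses. -/
lemma isRepsLeftQuotient_image_inv {𝒢 : Finset SL(2, ℤ)} (h : IsRepsRightQuotient q 𝒢) :
    IsRepsLeftQuotient q (𝒢.image (·⁻¹)) := by
  intro E
  obtain ⟨G, ⟨hG, hl⟩, hu⟩ := h E⁻¹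
  refine ⟨G⁻¹, ⟨Finset.mem_image_of_mem _ hG, ?_⟩, ?_⟩
  · rw [← isLowerMod_inv_iff] at hl ⊢
    rw [← isLowerMod_inv_iff]
    simpa using hl
  · rintro G' ⟨hG', hl'⟩
    obtain ⟨G₁, hG₁, rfl⟩ := Finset.mem_image.mp hG'
    rw [hu G₁ ⟨hG₁, ?_⟩]
    rw [← isLowerMod_inv_iff] at hl'
    simpa using hl'

lemma sum_repsRight {𝒢 : Finset SL(2, ℤ)} (h𝒢 : IsRepsRightQuotient q 𝒢)
    {φ : ZMod q × ZMod q → ℂ} (hφ : ∀ c : ZMod q, c ≠ 0 → ∀ v, φ (c • v) = φ v) :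
    ∑ G ∈ 𝒢, φ (firstRow q G⁻¹) =
      ((q : ℂ) - 1)⁻¹ * ∑ v ∈ Finset.univ.erase (0 : ZMod q × ZMod q), φ v := by
  rw [← sum_repsLeft (isRepsLeftQuotient_image_inv h𝒢) hφ, Finset.sum_image (by simp)]

end Reduction

/-! ### The upper half space -/

section HalfSpace

/-- Entrywise cast of an integral matrix to the complex numbers. -/
abbrev toC (A : Matrix (Fin 2) (Fin 2) ℤ) : Matrix (Fin 2) (Fin 2) ℂ := A.map (Int.cast : ℤ → ℂ)

lemma toC_mul (A B : Matrix (Fin 2) (Fin 2) ℤ) : toC (A * B) = toC A * toC B :=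
  Matrix.map_mul (f := Int.castRingHom ℂ)

lemma toC_add (A B : Matrix (Fin 2) (Fin 2) ℤ) : toC (A + B) = toC A + toC B :=
  Matrix.map_add _ Int.cast_add A B

lemma toC_sub (A B : Matrix (Fin 2) (Fin 2) ℤ) : toC (A - B) = toC A - toC B :=
  Matrix.map_sub _ Int.cast_sub A B

lemma toC_zero : toC 0 = 0 := Matrix.map_zero _ Int.cast_zero

lemma toC_one : toC 1 = 1 := Matrix.map_one _ Int.cast_zero Int.cast_one

lemma toC_transpose (A : Matrix (Fin 2) (Fin 2) ℤ) : toC Aᵀ = (toC A)ᵀ := rfl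

lemma toC_smul (n : ℤ) (A : Matrix (Fin 2) (Fin 2) ℤ) : toC (n • A) = (n : ℂ) • toC A := by
  ext i j; simp [-zsmul_eq_mul]

lemma det_toC (A : Matrix (Fin 2) (Fin 2) ℤ) : (toC A).det = (A.det : ℂ) :=
  ((Int.castRingHom ℂ).map_det A).symm

lemma toC_conjTranspose (A : Matrix (Fin 2) (Fin 2) ℤ) : (toC A)ᴴ = (toC A)ᵀ := by
  ext i j; simp

lemma add_mem_upperHalfSpace {τ R : Matrix (Fin 2) (Fin 2) ℂ} (hτ : τ ∈ upperHalfSpace)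
    (hR : R.IsSymm) (hR' : R.map Complex.im = 0) : τ + R ∈ upperHalfSpace := by
  refine ⟨hτ.1.add hR, ?_⟩
  rw [Matrix.map_add _ Complex.add_im, hR', add_zero]
  exact hτ.2

lemma smul_mem_upperHalfSpace {τ : Matrix (Fin 2) (Fin 2) ℂ} (hτ : τ ∈ upperHalfSpace)
    {r : ℕ} (hr : 0 < r) : (r : ℂ) • τ ∈ upperHalfSpace := by
  refine ⟨hτ.1.smul _, ?_⟩
  have : ((r : ℂ) • τ).map Complex.im = (r : ℝ) • τ.map Complex.im := by ext i j; simp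
  rw [this]
  exact hτ.2.smul (by exact_mod_cast hr)

/-- For symmetric `τ` the conjugate transpose is the entrywise conjugate. Thus the cocycle relation
at `σ = τᴴ` has the imaginary part on its right side. -/
lemma conjTranspose_sub_self {τ : Matrix (Fin 2) (Fin 2) ℂ} (hτ : τ.IsSymm) :
    τ - τᴴ = (2 * Complex.I) • (τ.map Complex.im).map Complex.ofReal := by
  ext i j
  have h : τ j i = τ i j := hτ.apply i j
  simp only [Matrix.sub_apply, conjTranspose_apply, Matrix.smul_apply, map_apply, smul_eq_mul, h]
  apply Complex.ext <;> simp
  ring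

open scoped ComplexOrder in
/-- A real symmetric matrix is positive definite if and only if it is so over `ℂ`. -/
lemma posDef_map_ofReal_iff {M : Matrix (Fin 2) (Fin 2) ℝ} :
    (M.map Complex.ofReal).PosDef ↔ M.PosDef := by
  rw [posDef_iff_dotProduct_mulVec, posDef_iff_dotProduct_mulVec]
  have hH : (M.map Complex.ofReal).IsHermitian ↔ M.IsHermitian := by
    rw [IsHermitian, IsHermitian, ← Matrix.map_injective Complex.ofReal_injective |>.eq_iff]
    have : (M.map Complex.ofReal)ᴴ = Mᴴ.map Complex.ofReal := by ext i j; simp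
    rw [this]
  rw [hH]
  refine and_congr_right fun hM => ?_
  constructor
  · intro h x hx
    have h1 := h (x := fun i => (x i : ℂ)) (fun h0 => hx (by
      ext i; simpa using congrFun h0 i))
    have h2 : star (fun i => (x i : ℂ)) ⬝ᵥ (M.map Complex.ofReal) *ᵥ (fun i => (x i : ℂ)) =
        ((star x ⬝ᵥ M *ᵥ x : ℝ) : ℂ) := by
      simp [dotProduct, mulVec]
    rw [h2] at h1
    exact_mod_cast h1
  · intro h x hx
    have hsym : M 1 0 = M 0 1 := by simpa using (hM.apply 1 0).symm
    have h2 : star x ⬝ᵥ (M.map Complex.ofReal) *ᵥ x =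
        ((star (fun i => (x i).re) ⬝ᵥ M *ᵥ (fun i => (x i).re) +
          star (fun i => (x i).im) ⬝ᵥ M *ᵥ (fun i => (x i).im) : ℝ) : ℂ) := by
      apply Complex.ext <;> simp [dotProduct, mulVec, Fin.sum_univ_two, hsym] <;> ring
    rw [h2]
    have nn : ∀ y : Fin 2 → ℝ, 0 ≤ star y ⬝ᵥ M *ᵥ y := fun y => by
      by_cases hy : y = 0
      · simp [hy]
      · exact (h hy).le
    have : 0 < star (fun i => (x i).re) ⬝ᵥ M *ᵥ (fun i => (x i).re) +
          star (fun i => (x i).im) ⬝ᵥ M *ᵥ (fun i => (x i).im) := by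
      by_cases hr : (fun i => (x i).re) = 0
      · have hi : (fun i => (x i).im) ≠ 0 := fun hi => hx (by
          ext i
          exact Complex.ext (congrFun hr i) (congrFun hi i))
        exact add_pos_of_nonneg_of_pos (nn _) (h hi)
      · exact add_pos_of_pos_of_nonneg (h hr) (nn _)
    exact_mod_cast this

variable {A B C D : Matrix (Fin 2) (Fin 2) ℤ} {τ : Matrix (Fin 2) (Fin 2) ℂ}

lemma toC_symplectic (h : fromBlocks A B C D ∈ symplecticGroup (Fin 2) ℤ) :
    (toC A)ᵀ * toC C = (toC C)ᵀ * toC A ∧ (toC B)ᵀ * toC D = (toC D)ᵀ * toC B ∧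
      (toC A)ᵀ * toC D - (toC C)ᵀ * toC B = 1 := by
  obtain ⟨h1, h2, h3⟩ := SymplecticGroup.fromBlocks_mem_iff.mp h
  simp only [← toC_transpose, ← toC_mul, h1, h2, ← toC_sub, h3, toC_one, and_self]

/-- The fundamental relation for a symplectic matrix acting on two points. -/
lemma symplectic_cocycle (h : fromBlocks A B C D ∈ symplecticGroup (Fin 2) ℤ)
    (σ τ : Matrix (Fin 2) (Fin 2) ℂ) :
    (σ * (toC C)ᵀ + (toC D)ᵀ) * (toC A * τ + toC B) -
      (σ * (toC A)ᵀ + (toC B)ᵀ) * (toC C * τ + toC D) = τ - σ := by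
  obtain ⟨h1, h2, h3⟩ := toC_symplectic h
  have h4 : (toC D)ᵀ * toC A - (toC B)ᵀ * toC C = 1 := by
    have := congrArg Matrix.transpose h3
    simpa using this
  calc _ = -(σ * ((toC A)ᵀ * toC C - (toC C)ᵀ * toC A) * τ)
        + ((toC D)ᵀ * toC A - (toC B)ᵀ * toC C) * τ
        - σ * ((toC A)ᵀ * toC D - (toC C)ᵀ * toC B)
        - ((toC B)ᵀ * toC D - (toC D)ᵀ * toC B) := by noncomm_ring
    _ = _ := by rw [h1, h2, h3, h4]; simp

open scoped ComplexOrder in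
-- If `(Cτ + D)v = 0`, the cocycle relation at `σ = τᴴ`, evaluated on `v`, gives `2i v* Im(τ) v =
-- 0`; hence `v = 0`.
lemma isUnit_det_denominator (h : fromBlocks A B C D ∈ symplecticGroup (Fin 2) ℤ)
    (hτ : τ ∈ upperHalfSpace) : IsUnit (toC C * τ + toC D).det := by
  rw [isUnit_iff_ne_zero]
  intro hdet
  obtain ⟨v, hv, hv0⟩ := Matrix.exists_mulVec_eq_zero_iff.mpr hdet
  have hc := symplectic_cocycle h τᴴ τ
  have hQ : τᴴ * (toC C)ᵀ + (toC D)ᵀ = (toC C * τ + toC D)ᴴ := by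
    rw [conjTranspose_add, conjTranspose_mul, toC_conjTranspose, toC_conjTranspose]
  rw [hQ, conjTranspose_sub_self hτ.1] at hc
  have h1 := congrArg (fun M => star v ⬝ᵥ M *ᵥ v) hc
  simp only [sub_mulVec, ← mulVec_mulVec, hv0, mulVec_zero, sub_zero] at h1
  rw [dotProduct_mulVec, ← star_mulVec, hv0, star_zero, zero_dotProduct, smul_mulVec,
    dotProduct_smul, smul_eq_mul] at h1
  have h2 := (posDef_iff_dotProduct_mulVec.mp (posDef_map_ofReal_iff.mpr hτ.2)).2 hv
  rcases mul_eq_zero.mp h1.symm with h3 | h3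
  · simp at h3
  · exact h2.ne' h3

open scoped ComplexOrder in
-- With `P = Aτ + B` and `Q = Cτ + D`, the cocycle relation at `σ = τ` makes `PQ⁻¹` symmetric, and
-- at `σ = τᴴ` it gives `Im(PQ⁻¹) = (Q⁻¹)ᴴ Im(τ) Q⁻¹`, which is positive definite.
lemma action_mem_upperHalfSpace (h : fromBlocks A B C D ∈ symplecticGroup (Fin 2) ℤ)
    (hτ : τ ∈ upperHalfSpace) :
    (toC A * τ + toC B) * (toC C * τ + toC D)⁻¹ ∈ upperHalfSpace := by
  have hu := isUnit_det_denominator h hτ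
  have hc1 := symplectic_cocycle h τ τ
  have hc2 := symplectic_cocycle h τᴴ τ
  have e1 : τ * (toC C)ᵀ + (toC D)ᵀ = (toC C * τ + toC D)ᵀ := by
    rw [transpose_add, transpose_mul, hτ.1.eq]
  have e2 : τ * (toC A)ᵀ + (toC B)ᵀ = (toC A * τ + toC B)ᵀ := by
    rw [transpose_add, transpose_mul, hτ.1.eq]
  have e3 : τᴴ * (toC C)ᵀ + (toC D)ᵀ = (toC C * τ + toC D)ᴴ := by
    rw [conjTranspose_add, conjTranspose_mul, toC_conjTranspose, toC_conjTranspose]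
  have e4 : τᴴ * (toC A)ᵀ + (toC B)ᵀ = (toC A * τ + toC B)ᴴ := by
    rw [conjTranspose_add, conjTranspose_mul, toC_conjTranspose, toC_conjTranspose]
  rw [e1, e2, sub_self, sub_eq_zero] at hc1
  rw [e3, e4, conjTranspose_sub_self hτ.1] at hc2
  set P := toC A * τ + toC B
  set Q := toC C * τ + toC D
  have hQ1 : Q * Q⁻¹ = 1 := Matrix.mul_nonsing_inv _ hu
  have hQ2 : Q⁻¹ * Q = 1 := Matrix.nonsing_inv_mul _ hu
  have hQt : (Q⁻¹)ᵀ * Qᵀ = 1 := by rw [← transpose_mul, hQ1, transpose_one]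
  have hQh : (Q⁻¹)ᴴ * Qᴴ = 1 := by rw [← conjTranspose_mul, hQ1, conjTranspose_one]
  have hsymm : (P * Q⁻¹).IsSymm := by
    rw [IsSymm, transpose_mul]
    calc (Q⁻¹)ᵀ * Pᵀ = (Q⁻¹)ᵀ * (Pᵀ * Q) * Q⁻¹ := by
          rw [Matrix.mul_assoc, Matrix.mul_assoc, hQ1, Matrix.mul_one]
      _ = P * Q⁻¹ := by rw [← hc1, ← Matrix.mul_assoc, hQt, Matrix.one_mul]
  refine ⟨hsymm, ?_⟩
  have hI : (2 * Complex.I) ≠ 0 := by simp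
  have him : ((P * Q⁻¹).map Complex.im).map Complex.ofReal =
      (Q⁻¹)ᴴ * (τ.map Complex.im).map Complex.ofReal * Q⁻¹ := by
    apply smul_right_injective _ hI
    simp only
    rw [← conjTranspose_sub_self hsymm, ← Matrix.smul_mul, ← Matrix.mul_smul, ← hc2, Matrix.mul_sub,
      Matrix.sub_mul, ← Matrix.mul_assoc, hQh, Matrix.one_mul, conjTranspose_mul,
      Matrix.mul_assoc, Matrix.mul_assoc, hQ1, Matrix.mul_one]
  rw [← posDef_map_ofReal_iff, him]
  refine (posDef_map_ofReal_iff.mpr hτ.2).conjTranspose_mul_mul_same ?_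
  exact Matrix.mulVec_injective_of_isUnit ⟨⟨Q⁻¹, Q, hQ2, hQ1⟩, rfl⟩

end HalfSpace

/-! ### Translates of modular forms -/

section Translates

variable {A B C D : Matrix (Fin 2) (Fin 2) ℤ} {τ : Matrix (Fin 2) (Fin 2) ℂ}

lemma map_zmod_eq_zero {N : ℕ} (hC : ∀ i j, (N : ℤ) ∣ C i j) :
    C.map (Int.castRingHom (ZMod N)) = 0 := by
  ext i j
  simpa using (ZMod.intCast_zmod_eq_zero_iff_dvd (C i j) N).mpr (hC i j)

lemma transpose_mul_map_eq_one {N : ℕ} (h : fromBlocks A B C D ∈ symplecticGroup (Fin 2) ℤ)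
    (hC : ∀ i j, (N : ℤ) ∣ C i j) :
    (A.map (Int.castRingHom (ZMod N)))ᵀ * D.map (Int.castRingHom (ZMod N)) = 1 := by
  have h3 := congrArg (fun M => M.map (Int.castRingHom (ZMod N)))
    (SymplecticGroup.fromBlocks_mem_iff.mp h).2.2
  simp only [Matrix.map_sub _ (map_sub _), Matrix.map_mul, transpose_map,
    map_zmod_eq_zero hC, Matrix.map_one _ (map_zero _) (map_one _)] at h3
  simpa using h3

lemma isUnit_map_of_level {N : ℕ} (h : fromBlocks A B C D ∈ symplecticGroup (Fin 2) ℤ)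
    (hC : ∀ i j, (N : ℤ) ∣ C i j) : IsUnit (D.map (Int.castRingHom (ZMod N))) :=
  IsUnit.of_mul_eq_one_right _ (transpose_mul_map_eq_one h hC)

lemma isCoprime_det {N : ℕ} (h : fromBlocks A B C D ∈ symplecticGroup (Fin 2) ℤ)
    (hC : ∀ i j, (N : ℤ) ∣ C i j) : IsCoprime D.det N := by
  have hu := (Matrix.isUnit_iff_isUnit_det _).mp (isUnit_map_of_level h hC)
  rw [← RingHom.mapMatrix_apply, ← RingHom.map_det] at hu
  exact ((ZMod.coe_int_isUnit_iff_isCoprime _ _).mp hu).symm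

/-- On integers prime to `N` the character agrees with its primitive character. Coprimality matters,
since `χ` vanishes elsewhere while the primitive character need not. -/
lemma character_eq_of_modEq_conductor {N : ℕ} (χ : DirichletCharacter ℂ N) {a b : ℤ}
    (ha : IsCoprime a N) (hb : IsCoprime b N)
    (hab : (a : ZMod χ.conductor) = b) : χ a = χ b := by
  rw [← χ.primitiveCharacter_apply_of_isCoprime ha, ← χ.primitiveCharacter_apply_of_isCoprime hb,
    hab]

/-- The translations by `S/q` are not integral, so the product is shown to be symplectic over `ℂ`
and the relations descend to its integral blocks. -/
lemma mem_symplectic_of_toC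
    (h : fromBlocks (toC A) (toC B) (toC C) (toC D) ∈ symplecticGroup (Fin 2) ℂ) :
    fromBlocks A B C D ∈ symplecticGroup (Fin 2) ℤ := by
  rw [SymplecticGroup.fromBlocks_mem_iff] at h ⊢
  have hinj : Function.Injective toC := Matrix.map_injective Int.cast_injective
  refine ⟨hinj ?_, hinj ?_, hinj ?_⟩
  · simpa only [toC_mul, toC_transpose] using h.1
  · simpa only [toC_mul, toC_transpose] using h.2.1
  · simpa only [toC_mul, toC_transpose, toC_sub, toC_one] using h.2.2

/-- Composing a symplectic matrix with translations on both sides. -/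
lemma translate_mem_symplectic {R : Type*} [CommRing R] {a b c d X X' : Matrix (Fin 2) (Fin 2) R}
    (hX : X.IsSymm) (hX' : X'.IsSymm) (h : fromBlocks a b c d ∈ symplecticGroup (Fin 2) R) :
    fromBlocks (a + X * c) (b + X * d - (a + X * c) * X') c (d - c * X') ∈
      symplecticGroup (Fin 2) R := by
  have ht : ∀ Z : Matrix (Fin 2) (Fin 2) R, Z.IsSymm →
      fromBlocks 1 Z 0 1 ∈ symplecticGroup (Fin 2) R := by
    intro Z hZ
    rw [SymplecticGroup.fromBlocks_mem_iff]
    simp [hZ.eq]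
  have := mul_mem (mul_mem (ht X hX) h) (ht (-X') hX'.neg)
  simp only [fromBlocks_multiply] at this
  convert this using 2
  · simp
  · noncomm_ring
  · simp
  · noncomm_ring

lemma toC_symplectic_mem (h : fromBlocks A B C D ∈ symplecticGroup (Fin 2) ℤ) :
    fromBlocks (toC A) (toC B) (toC C) (toC D) ∈ symplecticGroup (Fin 2) ℂ :=
  SymplecticGroup.fromBlocks_mem_iff.mpr (toC_symplectic h)

/-- The integral blocks obtained by composing a symplectic matrix with the translations by `S / q`
and `-ᵗD S D / q`. -/
lemma translate_integral_blocks {q : ℤ} (hq : q ≠ 0) {S C₂ : Matrix (Fin 2) (Fin 2) ℤ}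
    (h : fromBlocks A B (q ^ 2 • C₂) D ∈ symplecticGroup (Fin 2) ℤ)
    {X X' : Matrix (Fin 2) (Fin 2) ℂ} (hX : X = (q : ℂ)⁻¹ • toC S)
    (hX' : X' = (q : ℂ)⁻¹ • toC (Dᵀ * S * D)) :
    toC (A + q • (S * C₂)) = toC A + X * toC (q ^ 2 • C₂) ∧
    toC (B - q • (B * C₂ᵀ * S * D) - S * C₂ * (Dᵀ * S * D)) =
      toC B + X * toC D - (toC A + X * toC (q ^ 2 • C₂)) * X' ∧
    toC (D - q • (C₂ * (Dᵀ * S * D))) = toC D - toC (q ^ 2 • C₂) * X' := by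
  have hq0 : (q : ℂ) ≠ 0 := by exact_mod_cast hq
  have ht := SymplecticGroup.transpose_mem h
  rw [fromBlocks_transpose] at ht
  obtain ⟨-, -, h4⟩ := toC_symplectic ht
  simp only [toC_transpose, transpose_transpose, toC_smul, transpose_smul, Int.cast_pow] at h4
  -- Modulo `q²` the product `AᵗD` is the identity. This is why `ᵗDSD` is the right inner
  -- translation: `AX'` cancels `XD` up to an integral matrix.
  have h5 : toC A * (toC D)ᵀ = 1 + (q : ℂ) ^ 2 • (toC B * (toC C₂)ᵀ) := by
    rw [← h4, Matrix.mul_smul]; abel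
  have e1 : (q : ℂ)⁻¹ * q ^ 2 = q := by field_simp
  have e2 : (q : ℂ)⁻¹ * ((q : ℂ)⁻¹ * q ^ 2) = 1 := by field_simp
  subst hX hX'
  simp only [toC_add, toC_sub, toC_mul, toC_smul, toC_transpose, Int.cast_pow]
  refine ⟨?_, ?_, ?_⟩
  · simp only [Matrix.smul_mul, Matrix.mul_smul, smul_smul]
    rw [mul_comm, e1]
  · have h6 : toC A * ((toC D)ᵀ * toC S * toC D) =
        toC S * toC D + (q : ℂ) ^ 2 • (toC B * (toC C₂)ᵀ * toC S * toC D) := by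
      rw [Matrix.mul_assoc, ← Matrix.mul_assoc (toC A), h5, Matrix.add_mul, Matrix.one_mul,
        Matrix.smul_mul]
      simp only [Matrix.mul_assoc]
    simp only [Matrix.add_mul, Matrix.smul_mul, Matrix.mul_smul, smul_smul, h6, smul_add, e1]
    have e3 : (q : ℂ)⁻¹ * ((q : ℂ) ^ 2 * (q : ℂ)⁻¹) = 1 := by field_simp
    simp only [e3, one_smul]
    abel
  · simp only [Matrix.smul_mul, Matrix.mul_smul, smul_smul]
    congr 2
    field_simp

variable {k : ℤ} {N : ℕ} {χ : DirichletCharacter ℂ N} {f : Matrix (Fin 2) (Fin 2) ℂ → ℂ}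

lemma IsSiegelModularForm.transform_blocks (hf : IsSiegelModularForm k N χ f)
    (h : fromBlocks A B C D ∈ symplecticGroup (Fin 2) ℤ) (hC : ∀ i j, (N : ℤ) ∣ C i j)
    (hτ : τ ∈ upperHalfSpace) :
    f ((toC A * τ + toC B) * (toC C * τ + toC D)⁻¹) =
      χ (D.det : ℤ) * (toC C * τ + toC D).det ^ k * f τ := by
  simpa using hf.transform (fromBlocks A B C D) ⟨h, by simpa using hC⟩ τ hτ

/-- A modular form is periodic with respect to integral translations. -/
lemma IsSiegelModularForm.periodic (hf : IsSiegelModularForm k N χ f)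
    {S : Matrix (Fin 2) (Fin 2) ℤ} (hS : S.IsSymm) (hτ : τ ∈ upperHalfSpace) :
    f (τ + toC S) = f τ := by
  have h : fromBlocks 1 S 0 1 ∈ symplecticGroup (Fin 2) ℤ := by
    rw [SymplecticGroup.fromBlocks_mem_iff]
    simp [hS.eq]
  have := hf.transform_blocks h (by simp) hτ
  simpa [toC_one, toC_zero] using this

/-- A modular form is invariant under unimodular changes of variables. -/
lemma IsSiegelModularForm.unimodular (hf : IsSiegelModularForm k N χ f)
    {U V : Matrix (Fin 2) (Fin 2) ℤ} (hUV : U * V = 1) (hV : V.det = 1) (hτ : τ ∈ upperHalfSpace) :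
    f (toC Uᵀ * τ * toC U) = f τ := by
  have hVU : V * U = 1 := mul_eq_one_comm.mp hUV
  have h : fromBlocks Uᵀ 0 0 V ∈ symplecticGroup (Fin 2) ℤ := by
    rw [SymplecticGroup.fromBlocks_mem_iff]
    simp [hUV]
  have h1 := hf.transform_blocks h (by simp) hτ
  have hinv : (toC V)⁻¹ = toC U := Matrix.inv_eq_right_inv (by rw [← toC_mul, hVU, toC_one])
  rw [toC_zero, zero_mul, zero_add, add_zero, hinv, hV, det_toC, hV] at h1
  simpa using h1

/-- The transformation law of the translate of a modular form by `S / q`. -/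
lemma IsSiegelModularForm.transform_translate (hf : IsSiegelModularForm k N χ f)
    {q : ℕ} (hq : q ≠ 0) {M : ℕ} (hNM : N ∣ M) (hqM : q ^ 2 ∣ M) (hcond : q * χ.conductor ∣ M)
    (h : fromBlocks A B C D ∈ symplecticGroup (Fin 2) ℤ) (hC : ∀ i j, (M : ℤ) ∣ C i j)
    {S : Matrix (Fin 2) (Fin 2) ℤ} (hS : S.IsSymm) (hτ : τ ∈ upperHalfSpace) :
    f ((toC A * τ + toC B) * (toC C * τ + toC D)⁻¹ + (q : ℂ)⁻¹ • toC S) =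
      χ (D.det : ℤ) * (toC C * τ + toC D).det ^ k * f (τ + (q : ℂ)⁻¹ • toC (Dᵀ * S * D)) := by
  have hqZ : (q : ℤ) ≠ 0 := by exact_mod_cast hq
  have hCN : ∀ i j, (N : ℤ) ∣ C i j := fun i j => (Int.natCast_dvd_natCast.mpr hNM).trans (hC i j)
  have hCq : ∀ i j, ∃ x, C i j = (q : ℤ) ^ 2 * x := fun i j =>
    (Int.natCast_dvd_natCast.mpr hqM).trans (hC i j) |>.imp fun x hx => by simpa using hx
  choose c₂ hc₂ using hCq
  obtain ⟨C₂, rfl⟩ : ∃ C₂ : Matrix (Fin 2) (Fin 2) ℤ, C = (q : ℤ) ^ 2 • C₂ :=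
    ⟨of c₂, by ext i j; rw [Matrix.smul_apply, smul_eq_mul]; exact hc₂ i j⟩
  -- The condition on the conductor enters here; it says that the change `qC₂S'` of `D` is invisible
  -- to `χ`.
  have hC₂ : ∀ i j, (χ.conductor : ℤ) ∣ q * C₂ i j := by
    intro i j
    have h1 : ((q * χ.conductor : ℕ) : ℤ) ∣ ((q : ℤ) ^ 2 • C₂) i j :=
      (Int.natCast_dvd_natCast.mpr hcond).trans (hC i j)
    rw [Matrix.smul_apply, smul_eq_mul, Nat.cast_mul, sq, mul_assoc] at h1
    exact Int.dvd_of_mul_dvd_mul_left hqZ h1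
  set S' := Dᵀ * S * D with hS'
  have hSt' : S'.IsSymm := by
    rw [IsSymm, hS', transpose_mul, transpose_mul, transpose_transpose, hS.eq, Matrix.mul_assoc]
  obtain ⟨e1, e2, e3⟩ := translate_integral_blocks hqZ h (S := S) rfl rfl
  simp only [← hS', Int.cast_natCast] at e1 e2 e3
  have hsymm : ∀ {Z : Matrix (Fin 2) (Fin 2) ℤ}, Z.IsSymm → ((q : ℂ)⁻¹ • toC Z).IsSymm :=
    fun hZ => (hZ.map _).smul _
  have hmem := translate_mem_symplectic (hsymm hS) (hsymm hSt') (toC_symplectic_mem h)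
  rw [← e2, ← e1, ← e3] at hmem
  have hmem' := mem_symplectic_of_toC hmem
  have hτ' : τ + (q : ℂ)⁻¹ • toC S' ∈ upperHalfSpace := by
    refine add_mem_upperHalfSpace hτ (hsymm hSt') ?_
    ext i j
    simp
  have key := hf.transform_blocks hmem' hCN hτ'
  -- The shift of the argument and the change of `D` compensate, so the automorphy factor is that of
  -- the original matrix.
  have hden : toC ((q : ℤ) ^ 2 • C₂) * (τ + (q : ℂ)⁻¹ • toC S') +
      toC (D - (q : ℤ) • (C₂ * S')) = toC ((q : ℤ) ^ 2 • C₂) * τ + toC D := by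
    rw [e3, Matrix.mul_add]; abel
  have hu := isUnit_det_denominator h hτ
  set Q := toC ((q : ℤ) ^ 2 • C₂) * τ + toC D with hQ
  have hnum : toC (A + (q : ℤ) • (S * C₂)) * (τ + (q : ℂ)⁻¹ • toC S') +
      toC (B - (q : ℤ) • (B * C₂ᵀ * S * D) - S * C₂ * S') =
      (toC A * τ + toC B) + (q : ℂ)⁻¹ • toC S * Q := by
    rw [e1, e2, hQ]; noncomm_ring
  rw [hden, hnum, Matrix.add_mul, Matrix.mul_assoc, Matrix.mul_nonsing_inv _ hu, Matrix.mul_one]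
    at key
  rw [key]
  congr 2
  refine character_eq_of_modEq_conductor χ (isCoprime_det hmem' hCN) (isCoprime_det h hCN) ?_
  have hmap : (D - (q : ℤ) • (C₂ * S')).map (Int.castRingHom (ZMod χ.conductor)) =
      D.map (Int.castRingHom (ZMod χ.conductor)) := by
    have h0 : ((q : ℤ) • C₂).map (Int.castRingHom (ZMod χ.conductor)) = 0 :=
      map_zmod_eq_zero fun i j => by rw [Matrix.smul_apply, smul_eq_mul]; exact hC₂ i j
    rw [← Matrix.smul_mul, Matrix.map_sub _ (map_sub _), Matrix.map_mul, h0, Matrix.zero_mul,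
      sub_zero]
  have := congrArg Matrix.det hmap
  rw [← RingHom.mapMatrix_apply, ← RingHom.map_det, ← RingHom.mapMatrix_apply, ← RingHom.map_det]
    at this
  exact this

/-- The translate of `f` by a symmetric matrix modulo `q` divided by `q`. -/
def translate (q : ℕ) (f : Matrix (Fin 2) (Fin 2) ℂ → ℂ) (s : ZMod q × ZMod q × ZMod q)
    (τ : Matrix (Fin 2) (Fin 2) ℂ) : ℂ :=
  f (τ + (q : ℂ)⁻¹ • toC (symOf ((s.1.val : ℤ), (s.2.1.val : ℤ), (s.2.2.val : ℤ))))

lemma isSymm_symOf {R : Type*} (s : R × R × R) : (symOf s).IsSymm := by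
  ext i j; fin_cases i <;> fin_cases j <;> rfl

lemma add_inv_smul_mem {q : ℕ} (hτ : τ ∈ upperHalfSpace) {S : Matrix (Fin 2) (Fin 2) ℤ}
    (hS : S.IsSymm) : τ + (q : ℂ)⁻¹ • toC S ∈ upperHalfSpace := by
  refine add_mem_upperHalfSpace hτ ((hS.map _).smul _) ?_
  ext i j
  simp

/-- `S` and its reduced representative differ by `q` times an integral symmetric matrix, and `f` has
integral periods. -/
lemma IsSiegelModularForm.translate_redSym (hf : IsSiegelModularForm k N χ f) {q : ℕ} [NeZero q]
    {S : Matrix (Fin 2) (Fin 2) ℤ} (hS : S.IsSymm) (hτ : τ ∈ upperHalfSpace) :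
    translate q f (redSym q S) τ = f (τ + (q : ℂ)⁻¹ • toC S) := by
  have hq0 : (q : ℂ) ≠ 0 := by exact_mod_cast NeZero.ne q
  set S₀ : Matrix (Fin 2) (Fin 2) ℤ := symOf ((((S 0 0 : ℤ) : ZMod q).val : ℤ),
    (((S 0 1 : ℤ) : ZMod q).val : ℤ), (((S 1 1 : ℤ) : ZMod q).val : ℤ)) with hS₀
  have hdiv : ∀ x : ℤ, (x : ℤ) = ((x : ZMod q).val : ℤ) + q * (x / q) := by
    intro x
    rw [ZMod.val_intCast]
    exact (Int.emod_add_mul_ediv x q).symm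
  have hdec : S = S₀ + (q : ℤ) • symOf (S 0 0 / q, S 0 1 / q, S 1 1 / q) := by
    ext i j
    have h10 : S 1 0 = S 0 1 := hS.apply 0 1
    fin_cases i <;> fin_cases j <;>
      simp only [Fin.zero_eta, Fin.mk_one, Matrix.add_apply, Matrix.smul_apply, smul_eq_mul, hS₀,
        symOf, symMat, of_apply, cons_val', cons_val_zero, cons_val_one, cons_val_fin_one, h10] <;>
      exact hdiv _
  have : τ + (q : ℂ)⁻¹ • toC S = (τ + (q : ℂ)⁻¹ • toC S₀) +
      toC (symOf (S 0 0 / q, S 0 1 / q, S 1 1 / q)) := by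
    rw [(congrArg toC hdec).trans (toC_add _ _), toC_smul, smul_add, smul_smul, Int.cast_natCast,
      inv_mul_cancel₀ hq0, one_smul, add_assoc]
  rw [this, hf.periodic (isSymm_symOf _) (add_inv_smul_mem hτ (isSymm_symOf _))]
  rfl

end Translates

/-! ### Weighted sums of translates -/

section WeightedTwist

variable {k : ℤ} {N : ℕ} {χ : DirichletCharacter ℂ N} {f : Matrix (Fin 2) (Fin 2) ℂ → ℂ}

/-- The sum of the translates of `f` with the weight `w`. -/
def weightedTwist (q : ℕ) [NeZero q] (w : ZMod q × ZMod q × ZMod q → ℂ)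
    (f : Matrix (Fin 2) (Fin 2) ℂ → ℂ) (τ : Matrix (Fin 2) (Fin 2) ℂ) : ℂ :=
  ∑ s, w s * translate q f s τ

lemma isSiegelModularForm_of_blocks
    (hhol : DifferentiableOn ℂ (fun z : ℂ × ℂ × ℂ => f (symMat z.1 z.2.1 z.2.2))
      {z | symMat z.1 z.2.1 z.2.2 ∈ upperHalfSpace})
    (h : ∀ A B C D : Matrix (Fin 2) (Fin 2) ℤ, fromBlocks A B C D ∈ symplecticGroup (Fin 2) ℤ →
      (∀ i j, (N : ℤ) ∣ C i j) → ∀ τ ∈ upperHalfSpace,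
        f ((toC A * τ + toC B) * (toC C * τ + toC D)⁻¹) =
          χ (D.det : ℤ) * (toC C * τ + toC D).det ^ k * f τ) :
    IsSiegelModularForm k N χ f where
  holomorphic := hhol
  transform γ hγ τ hτ := by
    refine h _ _ _ _ ?_ hγ.2 τ hτ
    rw [fromBlocks_toBlocks]
    exact hγ.1

/-- The action preserves the half space, so values elsewhere are irrelevant. This is needed because
the twists are identified with weighted sums only there. -/
lemma IsSiegelModularForm.congr {g : Matrix (Fin 2) (Fin 2) ℂ → ℂ}
    (hg : IsSiegelModularForm k N χ g) (h : ∀ τ ∈ upperHalfSpace, f τ = g τ) :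
    IsSiegelModularForm k N χ f := by
  refine isSiegelModularForm_of_blocks (hg.holomorphic.congr fun z hz => h _ hz) ?_
  intro A B C D hs hC τ hτ
  rw [h _ (action_mem_upperHalfSpace hs hτ), h _ hτ, hg.transform_blocks hs hC hτ]

lemma symMat_add_const (z : ℂ × ℂ × ℂ) (s : ℂ × ℂ × ℂ) :
    symMat z.1 z.2.1 z.2.2 + symOf s =
      symMat (z + s).1 (z + s).2.1 (z + s).2.2 := by
  ext i j
  fin_cases i <;> fin_cases j <;> simp [symOf, symMat]

lemma inv_smul_toC_symOf (q : ℕ) (s : ℤ × ℤ × ℤ) :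
    (q : ℂ)⁻¹ • toC (symOf s) =
      symOf ((q : ℂ)⁻¹ * s.1, (q : ℂ)⁻¹ * s.2.1, (q : ℂ)⁻¹ * s.2.2) := by
  ext i j
  fin_cases i <;> fin_cases j <;> simp [symOf, symMat]

lemma IsSiegelModularForm.holomorphic_translate (hf : IsSiegelModularForm k N χ f) (q : ℕ)
    (s : ZMod q × ZMod q × ZMod q) :
    DifferentiableOn ℂ (fun z : ℂ × ℂ × ℂ => translate q f s (symMat z.1 z.2.1 z.2.2))
      {z | symMat z.1 z.2.1 z.2.2 ∈ upperHalfSpace} := by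
  simp only [translate, inv_smul_toC_symOf, symMat_add_const]
  refine hf.holomorphic.comp (f := fun z => z + _)
    (differentiable_id.add_const _).differentiableOn fun z hz => ?_
  have hmem := add_inv_smul_mem (q := q) hz
    (isSymm_symOf ((s.1.val : ℤ), (s.2.1.val : ℤ), (s.2.2.val : ℤ)))
  rw [inv_smul_toC_symOf, symMat_add_const] at hmem
  exact hmem

lemma redSym_congr (q : ℕ) [NeZero q] {S : Matrix (Fin 2) (Fin 2) ℤ} (hS : S.IsSymm)
    (V : Matrix (Fin 2) (Fin 2) ℤ) :
    redSym q (Vᵀ * S * V) = congrSym (V.map (Int.castRingHom (ZMod q))) (redSym q S) := by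
  have h := congrSym_map (Int.castRingHom (ZMod q)) V (S 0 0, S 0 1, S 1 1)
  rw [← symOf_entries hS, ← symOf_congrSym, symOf_entries hS]
  exact h.symm

lemma redSym_symOf (q : ℕ) (s : ℤ × ℤ × ℤ) :
    redSym q (symOf s) = ((s.1 : ZMod q), (s.2.1 : ZMod q), (s.2.2 : ZMod q)) := rfl

/-- An invariant weighted sum of translates is a modular form. -/
theorem IsSiegelModularForm.weightedTwist (hf : IsSiegelModularForm k N χ f)
    {q : ℕ} [Fact q.Prime] {w : ZMod q × ZMod q × ZMod q → ℂ} (hw : IsCongrInvariant w)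
    {M : ℕ} (hNM : N ∣ M) (hqM : q ^ 2 ∣ M) (hcond : q * χ.conductor ∣ M) :
    IsSiegelModularForm k M (DirichletCharacter.changeLevel hNM χ) (weightedTwist q w f) := by
  have hq0 : q ≠ 0 := NeZero.ne q
  refine isSiegelModularForm_of_blocks ?_ ?_
  · refine DifferentiableOn.fun_sum fun s _ => ?_
    exact (hf.holomorphic_translate q s).const_mul _
  · intro A B C D h hC τ hτ
    rw [DirichletCharacter.changeLevel_eq_cast_of_dvd' _ _ (isCoprime_det h hC)]
    have hDu : IsUnit (D.map (Int.castRingHom (ZMod q))) := isUnit_map_of_level h fun i j =>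
      (Int.natCast_dvd_natCast.mpr ((dvd_pow_self q two_ne_zero).trans hqM)).trans (hC i j)
    have hdet := (Matrix.isUnit_iff_isUnit_det _).mp hDu
    have hterm : ∀ s, translate q f s ((toC A * τ + toC B) * (toC C * τ + toC D)⁻¹) =
        χ (D.det : ℤ) * (toC C * τ + toC D).det ^ k *
          translate q f (congrSym (D.map (Int.castRingHom (ZMod q))) s) τ := by
      intro s
      set S : Matrix (Fin 2) (Fin 2) ℤ :=
        symOf ((s.1.val : ℤ), (s.2.1.val : ℤ), (s.2.2.val : ℤ)) with hS
      have hSs : S.IsSymm := isSymm_symOf _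
      have hs : s = redSym q S := by
        rw [hS, redSym_symOf]; simp
      have hSt : (Dᵀ * S * D).IsSymm := by
        rw [IsSymm, transpose_mul, transpose_mul, transpose_transpose, hSs.eq, Matrix.mul_assoc]
      have h1 := hf.transform_translate hq0 hNM hqM hcond h hC hSs hτ
      rw [← hf.translate_redSym hSt hτ, redSym_congr q hSs, ← hs] at h1
      exact h1
    simp only [SiegelTwist.weightedTwist, hterm, Finset.mul_sum]
    -- Since `q ∣ C`, the block `D` is invertible modulo `q`, and `s ↦ ᵗDsD` reindexes the sum.
    refine Fintype.sum_equiv (congrEquiv _ _ (Matrix.mul_nonsing_inv _ hdet)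
      (Matrix.nonsing_inv_mul _ hdet)) _ _ fun s => ?_
    change _ = _ * (w (congrSym _ s) * translate q f (congrSym _ s) τ)
    rw [hw _ hDu]
    ring

/-- Rescaling the variable raises the level. -/
theorem IsSiegelModularForm.opB (hf : IsSiegelModularForm k N χ f) {q : ℕ} (hq : 0 < q) :
    IsSiegelModularForm k (q * N) (DirichletCharacter.changeLevel (Nat.dvd_mul_left N q) χ)
      (opB q f) := by
  have hq0 : (q : ℂ) ≠ 0 := by exact_mod_cast hq.ne'
  have hqZ : (q : ℤ) ≠ 0 := by exact_mod_cast hq.ne'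
  refine isSiegelModularForm_of_blocks ?_ ?_
  · have hscale : ∀ z : ℂ × ℂ × ℂ, (q : ℂ) • symMat z.1 z.2.1 z.2.2 =
        symMat ((q : ℂ) • z).1 ((q : ℂ) • z).2.1 ((q : ℂ) • z).2.2 := by
      intro z
      ext i j
      fin_cases i <;> fin_cases j <;> simp [symMat]
    simp only [SiegelTwist.opB, hscale]
    refine hf.holomorphic.comp (f := fun z => (q : ℂ) • z)
      (differentiable_id.const_smul (q : ℂ)).differentiableOn fun z hz => ?_
    rw [Set.mem_ofPred_eq, ← hscale]
    exact smul_mem_upperHalfSpace hz hq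
  · intro A B C D h hC τ hτ
    rw [DirichletCharacter.changeLevel_eq_cast_of_dvd' _ _ (isCoprime_det h hC)]
    have hC' : ∀ i j, ∃ x, C i j = (q : ℤ) * x ∧ (N : ℤ) ∣ x := by
      intro i j
      obtain ⟨x, hx⟩ := hC i j
      exact ⟨N * x, by rw [hx]; push_cast; ring, dvd_mul_right _ _⟩
    choose c hc hcN using hC'
    obtain ⟨C₁, rfl, hN⟩ : ∃ C₁ : Matrix (Fin 2) (Fin 2) ℤ, C = (q : ℤ) • C₁ ∧
        ∀ i j, (N : ℤ) ∣ C₁ i j :=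
      ⟨of c, by ext i j; rw [Matrix.smul_apply, smul_eq_mul]; exact hc i j, hcN⟩
    -- Conjugation by `τ ↦ qτ` turns `(A, B; qC₁, D)` into this matrix, with the same `D` and the
    -- same automorphy factor.
    have hmem : fromBlocks A ((q : ℤ) • B) C₁ D ∈ symplecticGroup (Fin 2) ℤ := by
      rw [SymplecticGroup.fromBlocks_mem_iff] at h ⊢
      obtain ⟨h1, h2, h3⟩ := h
      refine ⟨smul_right_injective _ hqZ ?_, ?_, ?_⟩
      · simpa only [transpose_smul, Matrix.smul_mul, Matrix.mul_smul] using h1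
      · rw [transpose_smul, Matrix.smul_mul, Matrix.mul_smul, h2]
      · simpa only [transpose_smul, Matrix.smul_mul, Matrix.mul_smul] using h3
    have key := hf.transform_blocks hmem hN (smul_mem_upperHalfSpace hτ hq)
    have e1 : toC A * (q : ℂ) • τ + toC ((q : ℤ) • B) = (q : ℂ) • (toC A * τ + toC B) := by
      rw [toC_smul, Matrix.mul_smul, smul_add, Int.cast_natCast]
    have e2 : toC C₁ * (q : ℂ) • τ = toC ((q : ℤ) • C₁) * τ := by
      rw [toC_smul, Matrix.mul_smul, Matrix.smul_mul, Int.cast_natCast]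
    rw [e1, e2, Matrix.smul_mul] at key
    exact key

end WeightedTwist

/-! ### The twists as weighted sums of translates -/

section Twists

variable {k : ℤ} {N : ℕ} {χ : DirichletCharacter ℂ N} {f : Matrix (Fin 2) (Fin 2) ℂ → ℂ}
  {τ : Matrix (Fin 2) (Fin 2) ℂ}

/-- With `U = V⁻¹`, the new argument is `ᵗUτU + S/q = ᵗU(τ + ᵗVSV/q)U`, and the outer unimodular
substitution leaves `f` unchanged. -/
lemma IsSiegelModularForm.slash_eq_translate (hf : IsSiegelModularForm k N χ f) (q : ℕ)
    [NeZero q] {V : Matrix (Fin 2) (Fin 2) ℤ} (hV : V.det = 1) (s : ℤ × ℤ × ℤ)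
    (hτ : τ ∈ upperHalfSpace) :
    slash k (fromBlocks ((V.map (Int.cast : ℤ → ℚ))ᵀ⁻¹)
      ((q : ℚ)⁻¹ • (symMat (s.1 : ℚ) s.2.1 s.2.2 * V.map (Int.cast : ℤ → ℚ))) 0
      (V.map (Int.cast : ℤ → ℚ))) f τ =
    translate q f (congrSym (V.map (Int.castRingHom (ZMod q)))
      ((s.1 : ZMod q), (s.2.1 : ZMod q), (s.2.2 : ZMod q))) τ := by
  set S := symOf s with hS
  have hSs : S.IsSymm := isSymm_symOf s
  set U := V.adjugate with hU
  have hVU : V * U = 1 := by rw [hU, Matrix.mul_adjugate, hV, one_smul]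
  have hUV : U * V = 1 := mul_eq_one_comm.mp hVU
  have hcast : ∀ A : Matrix (Fin 2) (Fin 2) ℤ,
      (A.map (Int.cast : ℤ → ℚ)).map (Rat.cast : ℚ → ℂ) = toC A := by
    intro A; ext i j; simp
  have hinvQ : (V.map (Int.cast : ℤ → ℚ))ᵀ⁻¹ = Uᵀ.map (Int.cast : ℤ → ℚ) := by
    refine Matrix.inv_eq_right_inv ?_
    have := congrArg (fun M => Mᵀ.map (Int.castRingHom ℚ)) hUV
    simp only [transpose_mul, Matrix.map_mul, transpose_one,
      Matrix.map_one _ (map_zero _) (map_one _)] at this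
    exact this
  have hinvC : (toC V)⁻¹ = toC U := Matrix.inv_eq_right_inv (by rw [← toC_mul, hVU, toC_one])
  have hB : ((q : ℚ)⁻¹ • (symMat (s.1 : ℚ) s.2.1 s.2.2 * V.map (Int.cast : ℤ → ℚ))).map
      (Rat.cast : ℚ → ℂ) = (q : ℂ)⁻¹ • (toC S * toC V) := by
    rw [← toC_mul]
    ext i j
    fin_cases i <;> fin_cases j <;>
      simp [hS, symOf, symMat, vecMul, dotProduct, Fin.sum_univ_two]
  have hSt : (Vᵀ * S * V).IsSymm := by
    rw [IsSymm, transpose_mul, transpose_mul, transpose_transpose, hSs.eq, Matrix.mul_assoc]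
  rw [← redSym_symOf, ← redSym_congr q hSs, hf.translate_redSym hSt hτ]
  simp only [slash, toBlocks_fromBlocks₁₁, toBlocks_fromBlocks₁₂, toBlocks_fromBlocks₂₁,
    toBlocks_fromBlocks₂₂, hinvQ, hcast, hB]
  rw [Matrix.map_zero _ Rat.cast_zero, Matrix.zero_mul, zero_add, hinvC, det_toC, hV, Int.cast_one,
    _root_.one_zpow, one_mul, ← hf.unimodular hUV hV (add_inv_smul_mem hτ hSt)]
  congr 1
  have hVUc : toC V * toC U = 1 := by rw [← toC_mul, hVU, toC_one]
  have hUVt : toC Uᵀ * toC Vᵀ = 1 := by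
    rw [← toC_mul, ← transpose_mul, hVU, transpose_one, toC_one]
  rw [Matrix.mul_add, Matrix.add_mul, Matrix.add_mul]
  congr 1
  rw [toC_mul, toC_mul, Matrix.smul_mul, Matrix.mul_smul, Matrix.smul_mul]
  congr 1
  simp only [Matrix.mul_assoc]
  rw [hVUc, Matrix.mul_one, ← Matrix.mul_assoc, hUVt, Matrix.one_mul]

variable {q : ℕ} [Fact q.Prime]

lemma congrSym_rank_one (G : SL(2, ℤ)) (y : ZMod q) :
    congrSym ((G : Matrix (Fin 2) (Fin 2) ℤ).map (Int.castRingHom (ZMod q))) (y, 0, 0) =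
      (y * (firstRow q G).1 ^ 2, y * ((firstRow q G).1 * (firstRow q G).2),
        y * (firstRow q G).2 ^ 2) := by
  simp only [congrSym, firstRow, map_apply, eq_intCast, Prod.mk.injEq]
  refine ⟨?_, ?_, ?_⟩ <;> ring

theorem IsSiegelModularForm.opA0_eq (hf : IsSiegelModularForm k N χ f) {𝒢 : Finset SL(2, ℤ)}
    (h𝒢 : IsRepsLeftQuotient q 𝒢) (hτ : τ ∈ upperHalfSpace) :
    opA0 k q 𝒢 f τ = SiegelTwist.weightedTwist q (weight0 q) f τ := by
  have hterm : ∀ (G : SL(2, ℤ)) (y : ℕ),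
      slash k (fromBlocks ((ratMat G)ᵀ⁻¹) ((q : ℚ)⁻¹ • (symMat (y : ℚ) 0 0 * ratMat G))
        0 (ratMat G)) f τ =
      translate q f (congrSym ((G : Matrix (Fin 2) (Fin 2) ℤ).map (Int.castRingHom (ZMod q)))
        ((y : ZMod q), 0, 0)) τ := by
    intro G y
    have := hf.slash_eq_translate q G.det_coe ((y : ℤ), 0, 0) hτ
    simpa [ratMat] using this
  simp only [opA0, hterm, congrSym_rank_one]
  rw [SiegelTwist.weightedTwist, sum_weight0_mul, mul_inv, mul_assoc]
  congr 1
  rw [← sum_repsLeft (φ := fun v => ∑ y : ZMod q,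
    translate q f (y * v.1 ^ 2, y * (v.1 * v.2), y * v.2 ^ 2) τ) h𝒢]
  · refine Finset.sum_congr rfl fun G _ => ?_
    exact sum_range_eq_sum_zmod fun y => translate q f (y * (firstRow q G).1 ^ 2,
      y * ((firstRow q G).1 * (firstRow q G).2), y * (firstRow q G).2 ^ 2) τ
  · intro c hc v
    -- Scaling `v` by `c` scales `ᵗv v` by `c²`, which is absorbed by permuting `y`.
    refine Fintype.sum_bijective (fun y => y * c ^ 2)
      (mulRight_bijective₀ _ (pow_ne_zero 2 hc)) _ _ fun y => ?_
    simp only [Prod.smul_fst, Prod.smul_snd, smul_eq_mul]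
    congr 2
    · ring
    · congr 1 <;> ring

theorem IsSiegelModularForm.opA1_eq (hf : IsSiegelModularForm k N χ f) (hq : q ≠ 2)
    {𝒢 : Finset SL(2, ℤ)} (h𝒢 : IsRepsRightQuotient q 𝒢) (hτ : τ ∈ upperHalfSpace) :
    opA1 k q 𝒢 f τ = SiegelTwist.weightedTwist q (weight1 q) f τ := by
  have hterm : ∀ (G : SL(2, ℤ)) (y₁ y₂ y₄ : ℕ),
      slash k (fromBlocks ((ratMat G)⁻¹)
          ((q : ℚ)⁻¹ • (symMat (y₁ : ℚ) y₂ y₄ * (ratMat G)ᵀ)) 0 (ratMat G)ᵀ) f τ =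
      translate q f (congrSym ((G : Matrix (Fin 2) (Fin 2) ℤ).map (Int.castRingHom (ZMod q)))ᵀ
        ((y₁ : ZMod q), (y₂ : ZMod q), (y₄ : ZMod q))) τ := by
    intro G y₁ y₂ y₄
    have hdet : (G : Matrix (Fin 2) (Fin 2) ℤ)ᵀ.det = 1 := by rw [det_transpose, G.det_coe]
    -- Here `V = ᵗG`, so that `ᵗV⁻¹ = G⁻¹`.
    have := hf.slash_eq_translate q hdet ((y₁ : ℤ), (y₂ : ℤ), (y₄ : ℤ)) hτ
    simpa only [ratMat, transpose_map, transpose_transpose, Int.cast_natCast] using this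
  have hleg : ∀ y : ℕ, (legendreSym q (y : ℤ) : ℂ) = quadChar q (y : ZMod q) := by
    intro y
    rw [← quadChar_intCast, Int.cast_natCast]
  have hG : ∀ G : SL(2, ℤ), (∑ y₁ ∈ Finset.range q, ∑ y₂ ∈ Finset.range q, ∑ y₄ ∈ Finset.range q,
      quadChar q (y₁ : ZMod q) * translate q f
        (congrSym ((G : Matrix (Fin 2) (Fin 2) ℤ).map (Int.castRingHom (ZMod q)))ᵀ
          ((y₁ : ZMod q), (y₂ : ZMod q), (y₄ : ZMod q))) τ) =
      ∑ s : ZMod q × ZMod q × ZMod q, quadChar q ((firstRow q G⁻¹).1 ^ 2 * s.1 +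
        2 * ((firstRow q G⁻¹).1 * (firstRow q G⁻¹).2) * s.2.1 + (firstRow q G⁻¹).2 ^ 2 * s.2.2) *
          translate q f s τ := by
    intro G
    set Gq := (G : Matrix (Fin 2) (Fin 2) ℤ).map (Int.castRingHom (ZMod q)) with hGq
    set Hq := ((G⁻¹ : SL(2, ℤ)) : Matrix (Fin 2) (Fin 2) ℤ).map (Int.castRingHom (ZMod q)) with hHq
    have h1 : Gq * Hq = 1 := by
      rw [hGq, hHq, ← Matrix.map_mul, ← Matrix.SpecialLinearGroup.coe_mul, mul_inv_cancel,
        Matrix.SpecialLinearGroup.coe_one, Matrix.map_one _ (map_zero _) (map_one _)]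
    have h2 : Hq * Gq = 1 := mul_eq_one_comm.mp h1
    have hsum : ∀ F : ZMod q × ZMod q × ZMod q → ℂ,
        (∑ y₁ ∈ Finset.range q, ∑ y₂ ∈ Finset.range q, ∑ y₄ ∈ Finset.range q,
          F ((y₁ : ZMod q), (y₂ : ZMod q), (y₄ : ZMod q))) = ∑ s, F s := by
      intro F
      simp only [Fintype.sum_prod_type]
      rw [← sum_range_eq_sum_zmod]
      refine Finset.sum_congr rfl fun y₁ _ => ?_
      rw [← sum_range_eq_sum_zmod]
      refine Finset.sum_congr rfl fun y₂ _ => ?_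
      exact sum_range_eq_sum_zmod fun y₄ => F (y₁, y₂, y₄)
    rw [hsum fun s => quadChar q s.1 * translate q f (congrSym Gqᵀ s) τ]
    have h3 : Gqᵀ * Hqᵀ = 1 := by rw [← transpose_mul, h2, transpose_one]
    have h4 : Hqᵀ * Gqᵀ = 1 := by rw [← transpose_mul, h1, transpose_one]
    -- In the variable `s = GYᵗG` the entry `y₁` is the value of `s` at the first row of `G⁻¹`.
    refine Fintype.sum_equiv (congrEquiv Gqᵀ Hqᵀ h3 h4) _ _ fun s => ?_
    change _ = quadChar q (congrSym Hqᵀ (congrSym Gqᵀ s)).1 * translate q f (congrSym Gqᵀ s) τ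
    rw [← congrSym_mul, h3, congrSym_one]
  simp only [opA1, hterm, hleg, gaussSumQ_eq hq, hG]
  rw [sum_repsRight (φ := fun v => ∑ s : ZMod q × ZMod q × ZMod q, quadChar q (v.1 ^ 2 * s.1 +
        2 * (v.1 * v.2) * s.2.1 + v.2 ^ 2 * s.2.2) * translate q f s τ) h𝒢]
  · rw [← mul_assoc, ← mul_inv]
    simp only [SiegelTwist.weightedTwist, weight1, mul_assoc, Finset.sum_mul, ← Finset.mul_sum]
    congr 1
    -- The weight includes `v = 0`, unlike the sum over the projective line; its term vanishes.
    rw [Finset.sum_comm (s := Finset.univ (α := ZMod q × ZMod q × ZMod q)),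
      ← Finset.add_sum_erase _ _ (Finset.mem_univ (0 : ZMod q × ZMod q))]
    simp [quadChar_zero]
  · intro c hc v
    refine Finset.sum_congr rfl fun s _ => ?_
    congr 1
    rw [← quadChar_sq_mul hc (v.1 ^ 2 * s.1 + _ + _)]
    simp only [Prod.smul_fst, Prod.smul_snd, smul_eq_mul]
    congr 1
    ring

theorem IsSiegelModularForm.opA2_eq (hf : IsSiegelModularForm k N χ f) (hτ : τ ∈ upperHalfSpace) :
    opA2 k q f τ = SiegelTwist.weightedTwist q (weight2 q) f τ := by
  have hterm : ∀ (y₁ y₂ y₄ : ℕ),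
      slash k (fromBlocks 1 ((q : ℚ)⁻¹ • symMat (y₁ : ℚ) y₂ y₄) 0 1) f τ =
      translate q f ((y₁ : ZMod q), (y₂ : ZMod q), (y₄ : ZMod q)) τ := by
    intro y₁ y₂ y₄
    have := hf.slash_eq_translate q (V := 1) det_one ((y₁ : ℤ), (y₂ : ℤ), (y₄ : ℤ)) hτ
    simpa [congrSym_one] using this
  have hleg : ∀ y₁ y₂ y₄ : ℕ, (legendreSym q (symMat (y₁ : ℤ) y₂ y₄).det : ℂ) =
      quadChar q ((y₁ : ZMod q) * y₄ - y₂ ^ 2) := by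
    intro y₁ y₂ y₄
    rw [← quadChar_intCast, symMat, det_fin_two_of]
    push_cast
    rw [sq]
  have hm1 : (legendreSym q (-1) : ℂ) = quadChar q (-1) := by
    rw [← quadChar_intCast]; simp
  simp only [opA2, hterm, hleg, hm1, SiegelTwist.weightedTwist, weight2, mul_assoc,
    ← Finset.mul_sum]
  congr 2
  simp only [Fintype.sum_prod_type]
  rw [← sum_range_eq_sum_zmod]
  refine Finset.sum_congr rfl fun y₁ _ => ?_
  rw [← sum_range_eq_sum_zmod]
  refine Finset.sum_congr rfl fun y₂ _ => ?_
  exact sum_range_eq_sum_zmod fun y₄ => quadChar q ((y₁ : ZMod q) * y₄ - (y₂ : ZMod q) ^ 2) *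
    translate q f (y₁, y₂, y₄) τ

end Twists

/-! ### Fourier coefficients -/

section Fourier

lemma e_add (M M' : Matrix (Fin 2) (Fin 2) ℂ) : e (M + M') = e M * e M' := by
  rw [e, trace_add, mul_add, Complex.exp_add, e, e]

lemma trace_mul_symOf {R : Type*} [CommRing R] {T : Matrix (Fin 2) (Fin 2) R} (hT : T.IsSymm)
    (s : R × R × R) :
    (T * symOf s).trace = T 0 0 * s.1 + 2 * T 0 1 * s.2.1 + T 1 1 * s.2.2 := by
  have h10 : T 1 0 = T 0 1 := hT.apply 0 1
  simp [Matrix.trace, symOf, symMat, Matrix.mul_apply, Fin.sum_univ_two, h10]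
  ring

/-- The half of the trace of the product of an even and an integral matrix. -/
lemma exists_half_trace {T : Matrix (Fin 2) (Fin 2) ℤ} (hT : IsEvenIntegral T) (s : ℤ × ℤ × ℤ) :
    ∃ n : ℤ, (T * symOf s).trace = 2 * n := by
  obtain ⟨a, ha⟩ := hT.2 0
  obtain ⟨d, hd⟩ := hT.2 1
  refine ⟨a * s.1 + T 0 1 * s.2.1 + d * s.2.2, ?_⟩
  rw [trace_mul_symOf hT.1, ha, hd]
  ring

lemma trace_toC (A : Matrix (Fin 2) (Fin 2) ℤ) : (toC A).trace = (A.trace : ℂ) := by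
  simp [Matrix.trace, Fin.sum_univ_two]

lemma e_neg_mul_toC {T : Matrix (Fin 2) (Fin 2) ℤ} (hT : IsEvenIntegral T) (s : ℤ × ℤ × ℤ) :
    e (-(toC T * toC (symOf s))) = 1 := by
  obtain ⟨n, hn⟩ := exists_half_trace hT s
  rw [e, trace_neg, ← toC_mul, trace_toC, hn, Complex.exp_eq_one_iff]
  exact ⟨-n, by push_cast; ring⟩

/-- Evenness of `T` makes `n = ½ Tr(TS)` an integer. The exponential is `exp(2πi n/q)`, and `n`
reduces to the pairing because `2` is invertible modulo `q`. -/
lemma e_mul_inv_smul_toC {q : ℕ} [Fact q.Prime] (hq : q ≠ 2) {T : Matrix (Fin 2) (Fin 2) ℤ}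
    (hT : IsEvenIntegral T) (s : ℤ × ℤ × ℤ) :
    e (toC T * ((q : ℂ)⁻¹ • toC (symOf s))) =
      ZMod.stdAddChar (symPair (redSym q T) (redSym q (symOf s))) := by
  obtain ⟨n, hn⟩ := exists_half_trace hT s
  have hpair : symPair (redSym q T) (redSym q (symOf s)) = (n : ZMod q) := by
    rw [symPair, inv_mul_eq_iff_eq_mul₀ (two_ne_zero_zmod hq)]
    rw [trace_mul_symOf hT.1] at hn
    have := congrArg (Int.cast : ℤ → ZMod q) hn
    push_cast at this
    exact this
  rw [hpair, ZMod.stdAddChar_coe, e, Matrix.mul_smul, trace_smul, ← toC_mul, trace_toC, hn]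
  congr 1
  push_cast
  rw [smul_eq_mul]
  ring

/-- The point `X + iY` of the upper half space. -/
def point (Y : Matrix (Fin 2) (Fin 2) ℝ) (x : ℝ × ℝ × ℝ) : Matrix (Fin 2) (Fin 2) ℂ :=
  (symMat x.1 x.2.1 x.2.2).map Complex.ofReal + Complex.I • Y.map Complex.ofReal

variable {Y : Matrix (Fin 2) (Fin 2) ℝ}

lemma posDef_isSymm (hY : Y.PosDef) : Y.IsSymm := by
  have := hY.1
  rwa [IsHermitian, conjTranspose_eq_transpose_of_trivial] at this

lemma point_mem (hY : Y.PosDef) (x : ℝ × ℝ × ℝ) : point Y x ∈ upperHalfSpace := by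
  refine ⟨?_, ?_⟩
  · exact ((isSymm_symOf x).map _).add (((posDef_isSymm hY).map _).smul _)
  · have : (point Y x).map Complex.im = Y := by
      ext i j; simp [point]
    rwa [this]

lemma point_add (x r : ℝ × ℝ × ℝ) :
    point Y (x + r) = point Y x + symOf ((r.1 : ℂ), (r.2.1 : ℂ), (r.2.2 : ℂ)) := by
  ext i j
  fin_cases i <;> fin_cases j <;> simp [point, symOf, symMat] <;> ring

lemma point_eq_symMat (hY : Y.PosDef) (x : ℝ × ℝ × ℝ) :
    point Y x = symMat ((x.1 : ℂ) + Complex.I * Y 0 0) ((x.2.1 : ℂ) + Complex.I * Y 0 1)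
      ((x.2.2 : ℂ) + Complex.I * Y 1 1) := by
  have h10 : Y 1 0 = Y 0 1 := (posDef_isSymm hY).apply 0 1
  ext i j
  fin_cases i <;> fin_cases j <;> simp [point, symMat, h10]

/-- The integrand of a Fourier coefficient. -/
def fourierIntegrand (Y : Matrix (Fin 2) (Fin 2) ℝ) (f : Matrix (Fin 2) (Fin 2) ℂ → ℂ)
    (T : Matrix (Fin 2) (Fin 2) ℤ) (x : ℝ × ℝ × ℝ) : ℂ :=
  f (point Y x) * e (-(toC T * point Y x))

lemma coeffAt_eq (f : Matrix (Fin 2) (Fin 2) ℂ → ℂ) (T : Matrix (Fin 2) (Fin 2) ℤ) :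
    coeffAt Y f T = ∫ x₁ in (0 : ℝ)..1, ∫ x₂ in (0 : ℝ)..1, ∫ x₄ in (0 : ℝ)..1,
      fourierIntegrand Y f T (x₁, x₂, x₄) := rfl

lemma coeffAt_congr (hY : Y.PosDef) {f g : Matrix (Fin 2) (Fin 2) ℂ → ℂ}
    (h : ∀ τ ∈ upperHalfSpace, f τ = g τ) (T : Matrix (Fin 2) (Fin 2) ℤ) :
    coeffAt Y f T = coeffAt Y g T := by
  simp only [coeffAt_eq, fourierIntegrand, h _ (point_mem hY _)]

lemma continuous_fourierIntegrand (hY : Y.PosDef) {f : Matrix (Fin 2) (Fin 2) ℂ → ℂ}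
    (hf : ContinuousOn (fun z : ℂ × ℂ × ℂ => f (symMat z.1 z.2.1 z.2.2))
      {z | symMat z.1 z.2.1 z.2.2 ∈ upperHalfSpace}) (T : Matrix (Fin 2) (Fin 2) ℤ) :
    Continuous (fourierIntegrand Y f T) := by
  have hpoint : Continuous (point Y) := by
    refine continuous_matrix fun i j => ?_
    fin_cases i <;> fin_cases j <;> simp [point, symMat] <;> fun_prop
  refine Continuous.mul ?_ ?_
  · let g : ℝ × ℝ × ℝ → ℂ × ℂ × ℂ := fun x => ((x.1 : ℂ) + Complex.I * Y 0 0,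
      (x.2.1 : ℂ) + Complex.I * Y 0 1, (x.2.2 : ℂ) + Complex.I * Y 1 1)
    have hg : Continuous g := by fun_prop
    have := hf.comp_continuous hg fun x => by
      rw [Set.mem_ofPred_eq, ← point_eq_symMat hY]
      exact point_mem hY x
    simp only [point_eq_symMat hY]
    exact this
  · unfold e
    refine Complex.continuous_exp.comp (continuous_const.mul ?_)
    exact (continuous_const.matrix_mul hpoint).neg.matrix_trace

/-- Continuity of the partial integrals supplies integrability at each of the three stages. -/
lemma integral_triple_finset_sum {ι : Type*} (t : Finset ι) (c : ι → ℂ) {F : ι → ℝ × ℝ × ℝ → ℂ}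
    (hF : ∀ i, Continuous (F i)) :
    (∫ x₁ in (0 : ℝ)..1, ∫ x₂ in (0 : ℝ)..1, ∫ x₄ in (0 : ℝ)..1, ∑ i ∈ t, c i * F i (x₁, x₂, x₄)) =
      ∑ i ∈ t, c i * ∫ x₁ in (0 : ℝ)..1, ∫ x₂ in (0 : ℝ)..1, ∫ x₄ in (0 : ℝ)..1,
        F i (x₁, x₂, x₄) := by
  have h3 : ∀ i x₁ x₂, Continuous fun x₄ => c i * F i (x₁, x₂, x₄) := fun i x₁ x₂ =>
    continuous_const.mul ((hF i).comp (by fun_prop))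
  have h2 : ∀ i, Continuous fun p : ℝ × ℝ => ∫ x₄ in (0 : ℝ)..1, F i (p.1, p.2, x₄) := fun i =>
    intervalIntegral.continuous_parametric_intervalIntegral_of_continuous'
      (f := fun (p : ℝ × ℝ) x₄ => F i (p.1, p.2, x₄)) ((hF i).comp (by fun_prop)) 0 1
  have h2' : ∀ i x₁, Continuous fun x₂ => c i * ∫ x₄ in (0 : ℝ)..1, F i (x₁, x₂, x₄) :=
    fun i x₁ => continuous_const.mul ((h2 i).comp (continuous_const.prodMk continuous_id))
  have h1 : ∀ i, Continuous fun x₁ : ℝ => c i * ∫ x₂ in (0 : ℝ)..1, ∫ x₄ in (0 : ℝ)..1,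
      F i (x₁, x₂, x₄) := fun i => continuous_const.mul
    (intervalIntegral.continuous_parametric_intervalIntegral_of_continuous'
      (f := fun x₁ x₂ => ∫ x₄ in (0 : ℝ)..1, F i (x₁, x₂, x₄)) (h2 i) 0 1)
  have e3 : ∀ x₁ x₂, (∫ x₄ in (0 : ℝ)..1, ∑ i ∈ t, c i * F i (x₁, x₂, x₄)) =
      ∑ i ∈ t, c i * ∫ x₄ in (0 : ℝ)..1, F i (x₁, x₂, x₄) := by
    intro x₁ x₂
    rw [intervalIntegral.integral_finsetSum fun i _ => (h3 i x₁ x₂).intervalIntegrable _ _]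
    simp only [intervalIntegral.integral_const_mul]
  have e2 : ∀ x₁, (∫ x₂ in (0 : ℝ)..1, ∑ i ∈ t, c i * ∫ x₄ in (0 : ℝ)..1, F i (x₁, x₂, x₄)) =
      ∑ i ∈ t, c i * ∫ x₂ in (0 : ℝ)..1, ∫ x₄ in (0 : ℝ)..1, F i (x₁, x₂, x₄) := by
    intro x₁
    rw [intervalIntegral.integral_finsetSum fun i _ => (h2' i x₁).intervalIntegrable _ _]
    simp only [intervalIntegral.integral_const_mul]
  simp only [e3, e2]
  rw [intervalIntegral.integral_finsetSum fun i _ => (h1 i).intervalIntegrable _ _]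
  simp only [intervalIntegral.integral_const_mul]

lemma coeffAt_finset_sum (hY : Y.PosDef) {ι : Type*} (t : Finset ι) (c : ι → ℂ)
    {F : ι → Matrix (Fin 2) (Fin 2) ℂ → ℂ}
    (hF : ∀ i, ContinuousOn (fun z : ℂ × ℂ × ℂ => F i (symMat z.1 z.2.1 z.2.2))
      {z | symMat z.1 z.2.1 z.2.2 ∈ upperHalfSpace}) (T : Matrix (Fin 2) (Fin 2) ℤ) :
    coeffAt Y (fun τ => ∑ i ∈ t, c i * F i τ) T = ∑ i ∈ t, c i * coeffAt Y (F i) T := by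
  have h := integral_triple_finset_sum t c fun i => continuous_fourierIntegrand hY (hF i) T
  simp only [coeffAt_eq]
  rw [← h]
  simp only [fourierIntegrand, Finset.sum_mul, mul_assoc]

lemma integral_shift_of_periodic {g : ℝ → ℂ} (hg : Function.Periodic g 1) (r : ℝ) :
    ∫ x in (0 : ℝ)..1, g (x + r) = ∫ x in (0 : ℝ)..1, g x := by
  rw [intervalIntegral.integral_comp_add_right, zero_add, add_comm,
    hg.intervalIntegral_add_eq r 0, zero_add]

lemma integral_triple_shift {h : ℝ × ℝ × ℝ → ℂ}
    (h1 : ∀ x₁ x₂ x₄, h (x₁ + 1, x₂, x₄) = h (x₁, x₂, x₄))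
    (h2 : ∀ x₁ x₂ x₄, h (x₁, x₂ + 1, x₄) = h (x₁, x₂, x₄))
    (h4 : ∀ x₁ x₂ x₄, h (x₁, x₂, x₄ + 1) = h (x₁, x₂, x₄)) (r : ℝ × ℝ × ℝ) :
    (∫ x₁ in (0 : ℝ)..1, ∫ x₂ in (0 : ℝ)..1, ∫ x₄ in (0 : ℝ)..1, h ((x₁, x₂, x₄) + r)) =
      ∫ x₁ in (0 : ℝ)..1, ∫ x₂ in (0 : ℝ)..1, ∫ x₄ in (0 : ℝ)..1, h (x₁, x₂, x₄) := by
  obtain ⟨r₁, r₂, r₄⟩ := r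
  simp only [Prod.mk_add_mk]
  have e4 : ∀ x₁ x₂, (∫ x₄ in (0 : ℝ)..1, h (x₁, x₂, x₄ + r₄)) = ∫ x₄ in (0 : ℝ)..1, h (x₁, x₂, x₄) :=
    fun x₁ x₂ => integral_shift_of_periodic (g := fun x₄ => h (x₁, x₂, x₄)) (h4 x₁ x₂) r₄
  simp only [e4]
  have e2 : ∀ x₁, (∫ x₂ in (0 : ℝ)..1, ∫ x₄ in (0 : ℝ)..1, h (x₁, x₂ + r₂, x₄)) =
      ∫ x₂ in (0 : ℝ)..1, ∫ x₄ in (0 : ℝ)..1, h (x₁, x₂, x₄) := fun x₁ =>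
    integral_shift_of_periodic (g := fun x₂ => ∫ x₄ in (0 : ℝ)..1, h (x₁, x₂, x₄))
      (fun x₂ => by simp only [h2]) r₂
  simp only [e2]
  exact integral_shift_of_periodic
    (g := fun x₁ => ∫ x₂ in (0 : ℝ)..1, ∫ x₄ in (0 : ℝ)..1, h (x₁, x₂, x₄))
    (fun x₁ => by simp only [h1]) r₁

variable {k : ℤ} {N : ℕ} {χ : DirichletCharacter ℂ N} {f : Matrix (Fin 2) (Fin 2) ℂ → ℂ}

lemma IsSiegelModularForm.fourierIntegrand_add (hf : IsSiegelModularForm k N χ f) (hY : Y.PosDef)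
    {T : Matrix (Fin 2) (Fin 2) ℤ} (hT : IsEvenIntegral T) (s : ℤ × ℤ × ℤ) (x : ℝ × ℝ × ℝ) :
    fourierIntegrand Y f T (x + ((s.1 : ℝ), (s.2.1 : ℝ), (s.2.2 : ℝ))) =
      fourierIntegrand Y f T x := by
  have hp : point Y (x + ((s.1 : ℝ), (s.2.1 : ℝ), (s.2.2 : ℝ))) = point Y x + toC (symOf s) := by
    rw [point_add]
    congr 1
    ext i j
    fin_cases i <;> fin_cases j <;> simp [symOf, symMat]
  rw [fourierIntegrand, fourierIntegrand, hp, hf.periodic (isSymm_symOf s) (point_mem hY x),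
    Matrix.mul_add, neg_add, e_add, e_neg_mul_toC hT, mul_one]

/-- Moving `X` by `S/q` costs the factor `e{TS/q}`; the integral over a full period does not see the
move. The height `Y` stays fixed, so independence of `Y` is not needed. -/
theorem IsSiegelModularForm.coeffAt_translate (hf : IsSiegelModularForm k N χ f) {q : ℕ}
    [Fact q.Prime] (hq : q ≠ 2) (hY : Y.PosDef) {T : Matrix (Fin 2) (Fin 2) ℤ}
    (hT : IsEvenIntegral T) (s : ZMod q × ZMod q × ZMod q) :
    coeffAt Y (translate q f s) T =
      ZMod.stdAddChar (symPair (redSym q T) s) * coeffAt Y f T := by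
  set S : ℤ × ℤ × ℤ := ((s.1.val : ℤ), (s.2.1.val : ℤ), (s.2.2.val : ℤ)) with hS
  have hs : redSym q (symOf S) = s := by rw [redSym_symOf, hS]; simp
  set r : ℝ × ℝ × ℝ := ((q : ℝ)⁻¹ * S.1, (q : ℝ)⁻¹ * S.2.1, (q : ℝ)⁻¹ * S.2.2) with hr
  have hp : ∀ x, point Y (x + r) = point Y x + (q : ℂ)⁻¹ • toC (symOf S) := by
    intro x
    rw [point_add, inv_smul_toC_symOf]
    simp [hr]
  have hint : ∀ x, fourierIntegrand Y (translate q f s) T x =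
      ZMod.stdAddChar (symPair (redSym q T) s) * fourierIntegrand Y f T (x + r) := by
    intro x
    rw [fourierIntegrand, fourierIntegrand, hp, Matrix.mul_add, neg_add, e_add]
    have h1 := e_mul_inv_smul_toC hq hT S
    rw [hs] at h1
    have h2 : e (toC T * ((q : ℂ)⁻¹ • toC (symOf S))) *
        e (-(toC T * ((q : ℂ)⁻¹ • toC (symOf S)))) = 1 := by
      rw [← e_add, add_neg_cancel, e, trace_zero, mul_zero, Complex.exp_zero]
    rw [← h1]
    change f (point Y x + (q : ℂ)⁻¹ • toC (symOf S)) * _ = _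
    linear_combination (-f (point Y x + (q : ℂ)⁻¹ • toC (symOf S)) * e (-(toC T * point Y x))) * h2
  simp only [coeffAt_eq, hint, intervalIntegral.integral_const_mul]
  congr 1
  refine integral_triple_shift ?_ ?_ ?_ r
  · intro x₁ x₂ x₄
    simpa using hf.fourierIntegrand_add hY hT (1, 0, 0) (x₁, x₂, x₄)
  · intro x₁ x₂ x₄
    simpa using hf.fourierIntegrand_add hY hT (0, 1, 0) (x₁, x₂, x₄)
  · intro x₁ x₂ x₄
    simpa using hf.fourierIntegrand_add hY hT (0, 0, 1) (x₁, x₂, x₄)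

/-- The Fourier coefficients of a weighted sum of translates. -/
theorem IsSiegelModularForm.coeffAt_weightedTwist (hf : IsSiegelModularForm k N χ f) {q : ℕ}
    [Fact q.Prime] (hq : q ≠ 2) (hY : Y.PosDef) {T : Matrix (Fin 2) (Fin 2) ℤ}
    (hT : IsEvenIntegral T) (w : ZMod q × ZMod q × ZMod q → ℂ) :
    coeffAt Y (SiegelTwist.weightedTwist q w f) T = symHat w (redSym q T) * coeffAt Y f T := by
  have h := coeffAt_finset_sum hY Finset.univ w
    (fun s => (hf.holomorphic_translate q s).continuousOn) T
  rw [show SiegelTwist.weightedTwist q w f = fun τ => ∑ s, w s * translate q f s τ from rfl, h,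
    symHat, Finset.sum_mul]
  refine Finset.sum_congr rfl fun s _ => ?_
  rw [hf.coeffAt_translate hq hY hT, mul_assoc]

end Fourier

end SiegelTwist

end

/-! ### Levels and Fourier coefficients of the twists -/

open SiegelTwist in
theorem proposition3p1 (k : ℤ) (N' : ℕ) (hN' : 0 < N') (χ' : DirichletCharacter ℂ N')
    (q : ℕ) [Fact q.Prime] (hq : q ≠ 2)
    (𝒢₀ 𝒢₁ : Finset (Matrix.SpecialLinearGroup (Fin 2) ℤ))
    (h𝒢₀ : SiegelTwist.IsRepsLeftQuotient q 𝒢₀) (h𝒢₁ : SiegelTwist.IsRepsRightQuotient q 𝒢₁)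
    (f : Matrix (Fin 2) (Fin 2) ℂ → ℂ) (hf : SiegelTwist.IsSiegelModularForm k N' χ' f) :
    -- the levels
    SiegelTwist.IsSiegelModularForm k (q * N')
      (DirichletCharacter.changeLevel (Nat.dvd_mul_left N' q) χ') (SiegelTwist.opB q f) ∧
    (q * χ'.conductor ∣ Nat.lcm N' (q ^ 2) →
      SiegelTwist.IsSiegelModularForm k (Nat.lcm N' (q ^ 2))
        (DirichletCharacter.changeLevel (Nat.dvd_lcm_left N' (q ^ 2)) χ')
        (SiegelTwist.opA0 k q 𝒢₀ f) ∧
      SiegelTwist.IsSiegelModularForm k (Nat.lcm N' (q ^ 2))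
        (DirichletCharacter.changeLevel (Nat.dvd_lcm_left N' (q ^ 2)) χ')
        (SiegelTwist.opA1 k q 𝒢₁ f) ∧
      SiegelTwist.IsSiegelModularForm k (Nat.lcm N' (q ^ 2))
        (DirichletCharacter.changeLevel (Nat.dvd_lcm_left N' (q ^ 2)) χ')
        (SiegelTwist.opA2 k q f)) ∧
    -- the Fourier coefficients
    ∀ Y : Matrix (Fin 2) (Fin 2) ℝ, Y.PosDef →
    ∀ T : Matrix (Fin 2) (Fin 2) ℤ, SiegelTwist.IsEvenIntegral T →
      -- `A₀(q)`
      ((SiegelTwist.IsHyperbolicMod q T →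
          SiegelTwist.coeffAt Y (SiegelTwist.opA0 k q 𝒢₀ f) T =
            2 * SiegelTwist.coeffAt Y f T) ∧
        (SiegelTwist.IsAnisotropicMod q T →
          SiegelTwist.coeffAt Y (SiegelTwist.opA0 k q 𝒢₀ f) T = 0) ∧
        (∀ ν : ℤ, (ν : ZMod q) ≠ 0 → SiegelTwist.IsometricMod q T 0 (2 * ν) →
          SiegelTwist.coeffAt Y (SiegelTwist.opA0 k q 𝒢₀ f) T =
            SiegelTwist.coeffAt Y f T) ∧
        (SiegelTwist.IsometricMod q T 0 0 →
          SiegelTwist.coeffAt Y (SiegelTwist.opA0 k q 𝒢₀ f) T =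
            ((q : ℂ) + 1) * SiegelTwist.coeffAt Y f T)) ∧
      -- `A₁(q)`
      ((∀ ν : ℤ, (ν : ZMod q) ≠ 0 → SiegelTwist.IsometricMod q T (2 * ν) 0 →
          SiegelTwist.coeffAt Y (SiegelTwist.opA1 k q 𝒢₁ f) T =
            (legendreSym q ν : ℂ) * SiegelTwist.coeffAt Y f T) ∧
        ((¬ ∃ ν : ℤ, (ν : ZMod q) ≠ 0 ∧ SiegelTwist.IsometricMod q T (2 * ν) 0) →
          SiegelTwist.coeffAt Y (SiegelTwist.opA1 k q 𝒢₁ f) T = 0)) ∧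
      -- `A₂(q)`
      ((∀ μ : ZMod q, SiegelTwist.IsometricMod q T 0 μ →
          SiegelTwist.coeffAt Y (SiegelTwist.opA2 k q f) T =
            ((q : ℂ) - 1) * SiegelTwist.coeffAt Y f T) ∧
        (SiegelTwist.IsHyperbolicMod q T ∨ SiegelTwist.IsAnisotropicMod q T →
          SiegelTwist.coeffAt Y (SiegelTwist.opA2 k q f) T =
            -SiegelTwist.coeffAt Y f T)) := by
  have hdvd := Nat.dvd_lcm_left N' (q ^ 2)
  have hdvd' := Nat.dvd_lcm_right N' (q ^ 2)
  refine ⟨hf.opB (Fact.out : q.Prime).pos, fun hcond => ⟨?_, ?_, ?_⟩, fun Y hY T hT => ?_⟩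
  · exact (hf.weightedTwist isCongrInvariant_weight0 hdvd hdvd' hcond).congr
      fun τ hτ => hf.opA0_eq h𝒢₀ hτ
  · exact (hf.weightedTwist isCongrInvariant_weight1 hdvd hdvd' hcond).congr
      fun τ hτ => hf.opA1_eq hq h𝒢₁ hτ
  · exact (hf.weightedTwist isCongrInvariant_weight2 hdvd hdvd' hcond).congr
      fun τ hτ => hf.opA2_eq hτ
  have h2 := two_ne_zero_zmod hq
  -- Each coefficient becomes a value of `symHat` at `T` modulo `q` times `c(T)`; the rest is
  -- evaluation at diagonal forms.
  rw [coeffAt_congr hY (fun τ hτ => hf.opA0_eq h𝒢₀ hτ) T, hf.coeffAt_weightedTwist hq hY hT,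
    coeffAt_congr hY (fun τ hτ => hf.opA1_eq hq h𝒢₁ hτ) T, hf.coeffAt_weightedTwist hq hY hT,
    coeffAt_congr hY (fun τ hτ => hf.opA2_eq (q := q) hτ) T, hf.coeffAt_weightedTwist hq hY hT]
  have hT0 : ∀ {a b : ZMod q}, IsometricMod q T a b → _ :=
    fun h => symHat_of_isometricMod isCongrInvariant_weight0 hT.1 h
  have hT1 : ∀ {a b : ZMod q}, IsometricMod q T a b → _ :=
    fun h => symHat_of_isometricMod isCongrInvariant_weight1 hT.1 h
  have hT2 : ∀ {a b : ZMod q}, IsometricMod q T a b → _ :=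
    fun h => symHat_of_isometricMod isCongrInvariant_weight2 hT.1 h
  refine ⟨⟨fun h => ?_, ?_, fun ν hν h => ?_, fun h => ?_⟩, ⟨fun ν hν h => ?_, fun h => ?_⟩,
    fun μ h => ?_, ?_⟩
  · rw [hT0 h, symHat_weight0_hyperbolic hq]
  · rintro ⟨ω, hω, h⟩
    rw [hT0 h, symHat_weight0_anisotropic hq hω, zero_mul]
  · rw [hT0 h, symHat_weight0_rank_one hq (mul_ne_zero h2 hν), one_mul]
  · rw [hT0 h, symHat_weight0_zero hq]
  · rw [hT1 h, symHat_weight1 hq, if_pos rfl, if_neg (mul_ne_zero h2 hν), add_zero,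
      inv_mul_cancel_left₀ h2, quadChar_intCast]
  -- A nonzero `a` would give the excluded form with `ν = a/2`. So in a diagonalization of `T`, if
  -- one entry is zero the other is too, and both terms of `symHat_weight1` vanish.
  · have hno : ∀ {a : ZMod q}, IsometricMod q T a 0 → a = 0 := by
      intro a ha
      by_contra ha0
      obtain ⟨ν, hν⟩ := ZMod.intCast_surjective (2⁻¹ * a)
      refine h ⟨ν, ?_, ?_⟩
      · rw [hν]
        exact mul_ne_zero (inv_ne_zero h2) ha0
      · rwa [hν, mul_inv_cancel_left₀ h2]
    obtain ⟨a, b, hab⟩ := exists_isometricMod hq hT.1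
    rw [hT1 hab, symHat_weight1 hq, mul_eq_zero]
    left
    have e1 : (if b = 0 then quadChar q (2⁻¹ * a) else 0) = 0 := by
      split_ifs with hb
      · subst hb
        rw [hno hab, mul_zero, quadChar_zero]
      · rfl
    have e2 : (if a = 0 then quadChar q (2⁻¹ * b) else 0) = 0 := by
      split_ifs with ha
      · subst ha
        rw [hno (isometricMod_swap hT.1 hab), mul_zero, quadChar_zero]
      · rfl
    rw [e1, e2, add_zero]
  · rw [hT2 h, symHat_weight2_degenerate hq]
  · rintro (h | ⟨ω, hω, h⟩)
    · rw [hT2 h, symHat_weight2_nondegenerate hq one_ne_zero (neg_ne_zero.mpr one_ne_zero),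
        neg_one_mul]
    · have hω0 : ω ≠ 0 := by
        rintro rfl
        exact hω (IsSquare.zero)
      rw [hT2 h, symHat_weight2_nondegenerate hq one_ne_zero (neg_ne_zero.mpr hω0), neg_one_mul]
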